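/- **Setting.** Let $1\le K<T$ be integers. For each arm $k\in[K]$ let $(X^k_t)_{t\in[T]}$ be a $[0,1]$-valued process; all arms live on one probability space, each arm is stationary with mean $\mu_k=\mathbb E X^k_t$, and $\mathcal F_i=\sigma(X^k_j : k\in[K],\,1\le j\le i)$. Put $\mu_\star=\max_k\mu_k$, $\Delta_k=\mu_\star-\mu_k$ and $A_\lambda=\{k\in[K]:\Delta_k>\lambda\}$ for $\lambda\ge 0$. The pseudo-regret of decisions $(I_t)_{t\in[T]}$ is $R(T)=\mathbb E\sum_{t=1}^T(\mu_\star-\mu_{I_t})$. Let $\mathcal C$ be a linear space of bounded measurable functions on $[0,1]$ with a semi-norm $C(\cdot)$, and $\mathcal C_1=\{\varphi\in\mathcal C: C(\varphi)\le 1\}$; assume that $x\mapsto x$ belongs to $\mathcal C_1$. The mixing coefficients of arm $k$ are $$\Phi^k_{\mathcal C}(t)=\sup_{\varphi\in\mathcal C_1,\ i\ge 1,\ i+t\le T}\big\|\mathbb E[\varphi(X^k_{i+t})\mid\mathcal F_i]-\mathbb E[\varphi(X^k_{i+t})]\big\|_{L^\infty}.$$ In the *fast mixing scenario* with exponent $\alpha>\frac12$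 one has $\Phi^k_{\mathcal C}(t)\le t^{-\alpha}$ for all $k$ and all $t\ge 1$. **Constants.** Call $c$ *admissible* for $\alpha$ if $\sum_{j=1}^n j^{-3/2}\sum_{\ell=1}^j \ell^{-\alpha}\le c\sum_{j=1}^n j^{-1/2-\alpha}$ for all $n$. Write $M(c)=80\,c\sum_{j=1}^{\infty}j^{-1/2-\alpha}$. **Algorithm (Improved UCB).** Fix an admissible $c_0$ and put $M_0=M(c_0)$, $\mathcal A=4\sqrt e$, $\theta_s=2^{-s}$, $$n_s=\Big\lceil \frac{8(1+M_0)^2\log(\mathcal A T\theta_s^2)}{\theta_s^2}\Big\rceil,\qquad \Omega_s=(1+M_0)\sqrt{\frac{2\log(\mathcal A T\theta_s^2)}{n_s}} .$$ Start at time $\tau_0=1$ with $B_0=[K]$. For $s=0,1,2,\dots$, during the times $\tau_s,\dots,\tau_{s+1}-1$, where $\tau_{s+1}=\tau_s+|B_s|n_s$, pull each arm of $B_s$ exactly $n_s$ times, in an arbitrary order fixed in advance as a function of $s$ and $B_s$. Let $\hat\mu_{k,s}$ be the average of the $n_s$ observations of arm $k$ collected in epoch $s$, and let $B_{s+1}$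 be obtained from $B_s$ by discarding all arms $k$ with $\hat\mu_{k,s}+\Omega_s\le\max_{j\in B_s}\hat\mu_{j,s}-\Omega_s$. Stop when time $T$ is reached. **Theorem.** Let $\alpha>\frac12$ and let $c_0$ be admissible for $\alpha$. There is a constant $c_\alpha\ge c_0$, depending only on $\alpha$ (and on the choice of $c_0=c_0(\alpha)$), such that with $M=80\,c_\alpha\sum_{j=1}^{\infty}j^{-1/2-\alpha}$, in every fast mixing bandit problem with exponent $\alpha$ as above (for all $K$, $T$, $\mathcal C$, all joint laws of the arms, and all pulling orders) and for every $\lambda\ge \frac{e^{1/4}}{2\sqrt T}$, the pseudo-regret of Improved UCB satisfies $$R(T)\le (1+M)\sum_{k\in A_\lambda}\Big(\Delta_k+\frac{96}{\Delta_k}+\frac{32\log(T\Delta_k^2)}{\Delta_k}\Big)+64\sum_{k\in A_0\setminus A_\lambda}\frac1\lambda+\lambda T .$$ -/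

import Mathlib

open MeasureTheory
open scoped ENNReal

noncomputable section

namespace MixBandit

/-! ### Weak mixing -/

/-- A class of bounded (measurable) test functions on the output space `[0,1]`, forming a linear
space, together with a semi-norm on it. -/
structure TestClass where
  space : Submodule ℝ (unitInterval → ℝ)
  bounded : ∀ f ∈ space, ∃ b : ℝ, ∀ x, |f x| ≤ b
  measurable : ∀ f ∈ space, Measurable f
  seminorm : Seminorm ℝ space

/-- The functions of the class whose semi-norm is at most one. -/
def TestClass.unitBall (𝒞 : TestClass) : Set (unitInterval → ℝ) :=
  {f | ∃ h : f ∈ 𝒞.space, 𝒞.seminorm ⟨f, h⟩ ≤ 1}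

variable {Ω : Type*}

/-- `jointHistory X i` is the σ-algebra generated by the outcomes `X k j` of *all* arms `k` at the
times `1 ≤ j ≤ i`. -/
abbrev jointHistory {K : ℕ} (X : Fin K → ℕ → Ω → unitInterval) (i : ℕ) : MeasurableSpace Ω :=
  ⨆ k : Fin K, ⨆ j ∈ Set.Icc 1 i, MeasurableSpace.comap (X k j) inferInstance

/-- The mixing coefficient with lag `t` of the process `Y 1, …, Y T` with respect to the history
`F`: the supremum over the test functions `φ` with semi-norm at most one, and over the times
`i ≥ 1` with `i + t ≤ T`, of `‖E[φ(Y (i+t)) | F i] - E[φ(Y (i+t))]‖_∞`. -/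
def mixingCoeff [MeasurableSpace Ω] (P : Measure Ω) (𝒞 : TestClass) (T : ℕ)
    (F : ℕ → MeasurableSpace Ω) (Y : ℕ → Ω → unitInterval) (t : ℕ) : ℝ≥0∞ :=
  ⨆ φ ∈ 𝒞.unitBall, ⨆ i ∈ {i : ℕ | 1 ≤ i ∧ i + t ≤ T},
    eLpNorm (fun ω => (P[fun ω' => φ (Y (i + t) ω') | F i]) ω - ∫ ω', φ (Y (i + t) ω') ∂P) ∞ P

/-- The fast mixing scenario with exponent `α`: every arm has `Φ(t) ≤ t ^ (-α)` for `t ≥ 1`. -/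
def FastMixing [MeasurableSpace Ω] (P : Measure Ω) (𝒞 : TestClass) {K : ℕ} (T : ℕ)
    (X : Fin K → ℕ → Ω → unitInterval) (α : ℝ) : Prop :=
  ∀ k : Fin K, ∀ t : ℕ, 1 ≤ t →
    mixingCoeff P 𝒞 T (jointHistory X) (X k) t ≤ ENNReal.ofReal ((t : ℝ) ^ (-α))

/-! ### Means, gaps, pseudo-regret -/

/-- The average outcome of the arm `k` (which does not depend on time for stationary arms). -/
def armMean [MeasurableSpace Ω] (P : Measure Ω) {K : ℕ} (X : Fin K → ℕ → Ω → unitInterval)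
    (k : Fin K) : ℝ :=
  ∫ ω, (X k 1 ω : ℝ) ∂P

/-- Every arm has a mean that is constant over the times `1, …, T`. -/
def StationaryMeans [MeasurableSpace Ω] (P : Measure Ω) {K : ℕ} (T : ℕ)
    (X : Fin K → ℕ → Ω → unitInterval) : Prop :=
  ∀ k : Fin K, ∀ t ∈ Finset.Icc 1 T, ∫ ω, (X k t ω : ℝ) ∂P = armMean P X k

/-- The average outcome of a best arm. -/
def bestMean [MeasurableSpace Ω] (P : Measure Ω) {K : ℕ} (X : Fin K → ℕ → Ω → unitInterval) : ℝ :=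
  ⨆ k : Fin K, armMean P X k

/-- The gap `Δ_k` of the arm `k`. -/
def gap [MeasurableSpace Ω] (P : Measure Ω) {K : ℕ} (X : Fin K → ℕ → Ω → unitInterval)
    (k : Fin K) : ℝ :=
  bestMean P X - armMean P X k

open Classical in
/-- The set of the arms whose gap exceeds `lam`; for `lam = 0`, the suboptimal arms. -/
def gapSet [MeasurableSpace Ω] (P : Measure Ω) {K : ℕ} (X : Fin K → ℕ → Ω → unitInterval)
    (lam : ℝ) : Finset (Fin K) :=
  Finset.univ.filter fun k => lam < gap P X k

/-- The pseudo-regret after `T` rounds of the (random) decisions `I 1, …, I T`. -/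
def pseudoRegret [MeasurableSpace Ω] (P : Measure Ω) {K : ℕ} (X : Fin K → ℕ → Ω → unitInterval)
    (T : ℕ) (I : ℕ → Ω → Fin K) : ℝ :=
  ∫ ω, ∑ t ∈ Finset.Icc 1 T, (bestMean P X - armMean P X (I t ω)) ∂P

/-! ### Constants -/

/-- `c` bounds the sums of mixing coefficients: for all `n`,
`∑_{j ≤ n} j^(-3/2) ∑_{l ≤ j} l^(-α) ≤ c ∑_{j ≤ n} j^(-1/2-α)`. -/
def AdmissibleConst (α c : ℝ) : Prop :=
  ∀ n : ℕ, ∑ j ∈ Finset.Icc 1 n, (j : ℝ) ^ (-(3 / 2) : ℝ) * ∑ l ∈ Finset.Icc 1 j, (l : ℝ) ^ (-α)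
    ≤ c * ∑ j ∈ Finset.Icc 1 n, (j : ℝ) ^ (-(1 / 2) - α)

/-- The factor `M = 80 c ∑_{j ≥ 1} j^(-1/2-α)`. -/
def mixFactor (α c : ℝ) : ℝ :=
  80 * c * ∑' j : ℕ, ((j : ℝ) + 1) ^ (-(1 / 2) - α)

/-! ### The Improved UCB algorithm

`M` is the factor used in the confidence radius, `T` the horizon. -/

/-- `log (𝒜 T θ_s²)` with `𝒜 = 4 √e` and `θ_s = 2^(-s)`, that is `log (𝒜 / δ_s)` for the
confidence level `δ_s = 1 / (T θ_s²)` of the epoch `s`. -/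
def logTerm (T s : ℕ) : ℝ :=
  Real.log (4 * Real.sqrt (Real.exp 1) * T * ((1 / 2 : ℝ) ^ s) ^ 2)

/-- The number of pulls of each active arm in the epoch `s`: the least number of pulls for which
the confidence radius is at most `θ_s / 2`. -/
def numPulls (M : ℝ) (T s : ℕ) : ℕ :=
  ⌈8 * (1 + M) ^ 2 * logTerm T s / ((1 / 2 : ℝ) ^ s) ^ 2⌉₊

/-- The confidence radius `(1 + M) √(2 log(𝒜 / δ_s) / n_s)` of the epoch `s`. -/
def radius (M : ℝ) (T s : ℕ) : ℝ :=
  (1 + M) * Real.sqrt (2 * logTerm T s / numPulls M T s)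

/-- A deterministic pulling rule: `order s B l` is the arm pulled at the position
`l = 0, 1, …, |B| n_s - 1` of the epoch `s` when `B` is the set of active arms. -/
abbrev PullOrder (K : ℕ) := ℕ → Finset (Fin K) → ℕ → Fin K

/-- In each epoch each active arm is pulled exactly `n_s` times (hence no other arm is). -/
def PullOrder.IsValid {K : ℕ} (order : PullOrder K) (M : ℝ) (T : ℕ) : Prop :=
  ∀ (s : ℕ) (B : Finset (Fin K)), ∀ k ∈ B,
    ((Finset.range (B.card * numPulls M T s)).filter fun l => order s B l = k).card
      = numPulls M T s

/-- The average of the observations of the arm `k` collected during the epoch `s`, if that epoch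
starts at the time `τ` with the set `B` of active arms; `x` is the realisation of the outcomes. -/
def epochMean {K : ℕ} (M : ℝ) (T : ℕ) (order : PullOrder K) (x : Fin K → ℕ → ℝ)
    (s τ : ℕ) (B : Finset (Fin K)) (k : Fin K) : ℝ :=
  (∑ l ∈ (Finset.range (B.card * numPulls M T s)).filter (fun l => order s B l = k), x k (τ + l))
    / numPulls M T s

open Classical in
/-- The starting time `τ_s` and the set `B_s` of active arms of the epoch `s`. At the end of an
epoch an arm `k` is discarded if `μ̂_k + radius ≤ max_{j ∈ B_s} μ̂_j - radius`. -/
def epochState {K : ℕ} (M : ℝ) (T : ℕ) (order : PullOrder K) (x : Fin K → ℕ → ℝ) :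
    ℕ → ℕ × Finset (Fin K)
  | 0 => (1, Finset.univ)
  | s + 1 =>
    let τ := (epochState M T order x s).1
    let B := (epochState M T order x s).2
    let est := epochMean M T order x s τ B
    (τ + B.card * numPulls M T s,
      B.filter fun k => ¬ ∃ j ∈ B, est k + radius M T s ≤ est j - radius M T s)

/-- The epoch to which the time `t` belongs: the first one after whose end `t` is over. -/
def epochOf {K : ℕ} (M : ℝ) (T : ℕ) (order : PullOrder K) (x : Fin K → ℕ → ℝ) (t : ℕ) : ℕ :=
  sInf {s : ℕ | t < (epochState M T order x (s + 1)).1}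

/-- The arm pulled by Improved UCB at the time `t`. -/
def decision {K : ℕ} (M : ℝ) (T : ℕ) (order : PullOrder K) (x : Fin K → ℕ → ℝ) (t : ℕ) : Fin K :=
  let s := epochOf M T order x t
  order s (epochState M T order x s).2 (t - (epochState M T order x s).1)

/-- Improved UCB played on the random outcomes `X`. -/
def improvedUCB {K : ℕ} (M : ℝ) (T : ℕ) (order : PullOrder K)
    (X : Fin K → ℕ → Ω → unitInterval) (t : ℕ) (ω : Ω) : Fin K :=
  decision M T order (fun k j => (X k j ω : ℝ)) t

end MixBandit

end

/-! Two ingredients combine: a concentration inequality that holds conditionally on the past, and a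
pathwise analysis of the elimination scheme.

Concentration. For a dyadic block of length `2 ^ (r + 1)`, the centred sum S - E[S | past] splits
into the centred sums of the two halves and the correction E[S₂ | midpoint] - E[S₂ | past]. The
halves behave like martingale increments, so their variance proxies add. The correction is bounded
through mixing, and its parameter adds linearly. Hence the sub-Gaussian parameters obey p(r+1) = √2
p(r) + 2 b(2^r) with b(n) = ∑_{l ≤ n} l^(-α), and p(r) / √2^r stays bounded because ∑ l^(-1/2-α)
converges for α > 1/2 (`isSubG_blockSum`, `blockParam_mixSum_le`). Chernoff's method then gives
`measureReal_sum_ge_le`. Arms are observed at scattered times, but spreading times out only improves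
mixing.

The start and the active set of an epoch are random and depend on the same outcomes. The tail bound
is therefore stated relative to P(H) for any event H of the past. It is applied with H fixing the
state (τ, B) of the epoch, and the disjoint states are summed at no cost
(`measurableSet_and_measureReal_firstBad_le`).

Elimination. As long as no epoch has been bad, some optimal arm stays active and every arm active in
epoch s has gap below 4θ_s (`OKBefore.spec`). This bounds the number of pulls of an arm in good
conditions by a geometric sum of the n_s. If r is the first bad epoch, all later pulls have gap
below 4θ_r, at total cost at most 4θ_r T, while the probability of this is of order 4^r / T times
the number of arms that may still be active. The factor T cancels and the sum over r is again
geometric.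

Since n_s is proportional to (1 + M₀)², the regret carries this square, and c_α is chosen large
enough to absorb it. -/

noncomputable section

namespace MixBandit

/-! ### Essentially bounded functions and conditionally sub-Gaussian variables -/

section SubGaussian

variable {Ω : Type*} {m₀ : MeasurableSpace Ω} {P : Measure Ω} {m m' : MeasurableSpace Ω}

/-- `f` is `m`-measurable and almost surely bounded. -/
def EssBounded (P : Measure Ω) (m : MeasurableSpace Ω) (f : Ω → ℝ) : Prop :=
  StronglyMeasurable[m] f ∧ ∃ C : ℝ, ∀ᵐ ω ∂P, |f ω| ≤ C

lemma EssBounded.mono {f : Ω → ℝ} (hf : EssBounded P m f) (h : m ≤ m') : EssBounded P m' f :=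
  ⟨hf.1.mono h, hf.2⟩

lemma EssBounded.integrable [IsFiniteMeasure P] {f : Ω → ℝ} (hf : EssBounded P m f)
    (h : m ≤ m₀) : Integrable f P := by
  obtain ⟨h1, C, hC⟩ := hf
  exact Integrable.of_bound (h1.mono h).aestronglyMeasurable C (by simpa using hC)

lemma EssBounded.add {f g : Ω → ℝ} (hf : EssBounded P m f) (hg : EssBounded P m g) :
    EssBounded P m (fun ω => f ω + g ω) := by
  obtain ⟨h1, C, hC⟩ := hf
  obtain ⟨h2, D, hD⟩ := hg
  refine ⟨h1.add h2, C + D, ?_⟩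
  filter_upwards [hC, hD] with ω a b
  exact (abs_add_le _ _).trans (add_le_add a b)

lemma EssBounded.mul {f g : Ω → ℝ} (hf : EssBounded P m f) (hg : EssBounded P m g) :
    EssBounded P m (fun ω => f ω * g ω) := by
  obtain ⟨h1, C, hC⟩ := hf
  obtain ⟨h2, D, hD⟩ := hg
  refine ⟨h1.mul h2, C * D, ?_⟩
  filter_upwards [hC, hD] with ω a b
  rw [abs_mul]
  exact mul_le_mul a b (abs_nonneg _) ((abs_nonneg _).trans a)

lemma EssBounded.const (c : ℝ) : EssBounded P m (fun _ => c) :=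
  ⟨stronglyMeasurable_const, |c|, by simp⟩

lemma EssBounded.sub {f g : Ω → ℝ} (hf : EssBounded P m f) (hg : EssBounded P m g) :
    EssBounded P m (fun ω => f ω - g ω) := by
  simpa [sub_eq_add_neg] using hf.add ((EssBounded.const (-1)).mul hg)

lemma EssBounded.exp {f : Ω → ℝ} (hf : EssBounded P m f) (u : ℝ) :
    EssBounded P m (fun ω => Real.exp (u * f ω)) := by
  obtain ⟨h1, C, hC⟩ := hf
  refine ⟨Real.continuous_exp.comp_stronglyMeasurable (h1.const_mul u), Real.exp (|u| * C), ?_⟩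
  filter_upwards [hC] with ω a
  rw [abs_of_pos (Real.exp_pos _)]
  refine Real.exp_le_exp.2 ((le_abs_self _).trans ?_)
  rw [abs_mul]
  gcongr

lemma EssBounded.sum {ι : Type*} (s : Finset ι) {f : ι → Ω → ℝ}
    (hf : ∀ i ∈ s, EssBounded P m (f i)) : EssBounded P m (fun ω => ∑ i ∈ s, f i ω) := by
  classical
  induction s using Finset.induction_on with
  | empty => simpa using EssBounded.const (P := P) (m := m) 0
  | insert a s ha ih =>
    simp only [Finset.sum_insert ha]
    exact (hf a (by simp)).add (ih fun i hi => hf i (by simp [hi]))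

lemma EssBounded.condExp {f : Ω → ℝ} (hf : EssBounded P m' f) : EssBounded P m (P[f | m]) := by
  obtain ⟨_, C, hC⟩ := hf
  exact ⟨stronglyMeasurable_condExp, C, ae_bdd_abs_condExp_of_ae_bdd_abs hC⟩

/-- `D` is sub-Gaussian with variance proxy `s ^ 2` conditionally on `m`: this is the bound on the
conditional moment generating function, tested against the weights measurable for `m`. -/
def IsSubG (P : Measure Ω) (m : MeasurableSpace Ω) (D : Ω → ℝ) (s : ℝ) : Prop :=
  ∀ w : Ω → ℝ, EssBounded P m w → (∀ ω, 0 ≤ w ω) → ∀ u : ℝ,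
    ∫ ω, w ω * Real.exp (u * D ω) ∂P ≤ Real.exp (u ^ 2 * s ^ 2 / 2) * ∫ ω, w ω ∂P

/-- By convexity, exp lies below its chord over [-uc, uc]. The chord is affine in d, so its second
term vanishes when integrated against a centred variable. -/
lemma exp_mul_le_cosh_add_sinh {c d : ℝ} (hc : 0 < c) (hd : |d| ≤ c) (u : ℝ) :
    Real.exp (u * d) ≤ Real.cosh (u * c) + Real.sinh (u * c) / c * d := by
  obtain ⟨h1, h2⟩ := abs_le.1 hd
  have h := convexOn_exp.2 (Set.mem_univ (u * c)) (Set.mem_univ (-(u * c)))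
    (show 0 ≤ (c + d) / (2 * c) by apply div_nonneg <;> linarith)
    (show 0 ≤ (c - d) / (2 * c) by apply div_nonneg <;> linarith) (by field_simp; ring)
  simp only [smul_eq_mul] at h
  have e : (c + d) / (2 * c) * (u * c) + (c - d) / (2 * c) * -(u * c) = u * d := by
    field_simp; ring
  rw [e] at h
  refine h.trans (le_of_eq ?_)
  rw [Real.cosh_eq, Real.sinh_eq]
  field_simp
  ring

lemma integral_mul_eq_zero_of_condExp_eq_zero [IsFiniteMeasure P] (hm : m ≤ m₀) {w D : Ω → ℝ}
    (hw : EssBounded P m w) (hD : EssBounded P m₀ D) (h0 : P[D | m] =ᵐ[P] 0) :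
    ∫ ω, w ω * D ω ∂P = 0 := by
  have h1 := condExp_mul_of_stronglyMeasurable_left (μ := P) hw.1
    (((hw.mono hm).mul hD).integrable le_rfl) (hD.integrable le_rfl)
  have h2 : P[w * D | m] =ᵐ[P] 0 := by
    filter_upwards [h1, h0] with ω a b
    simp [a, b]
  calc ∫ ω, w ω * D ω ∂P = ∫ ω, (P[w * D | m]) ω ∂P := (integral_condExp hm).symm
    _ = 0 := by rw [integral_congr_ae h2]; simp

lemma isSubG_of_bounded [IsFiniteMeasure P] (hm : m ≤ m₀) {D : Ω → ℝ} {c : ℝ} (hc : 0 < c)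
    (hD : StronglyMeasurable[m₀] D) (hb : ∀ᵐ ω ∂P, |D ω| ≤ c) (h0 : P[D | m] =ᵐ[P] 0) :
    IsSubG P m D c := by
  intro w hw w0 u
  have hDb : EssBounded P m₀ D := ⟨hD, c, hb⟩
  have hw' := hw.mono hm
  calc ∫ ω, w ω * Real.exp (u * D ω) ∂P
      ≤ ∫ ω, (Real.cosh (u * c) * w ω + Real.sinh (u * c) / c * (w ω * D ω)) ∂P := by
        refine integral_mono_ae ((hw'.mul (hDb.exp u)).integrable le_rfl)
          ((((EssBounded.const _).mul hw').add
            ((EssBounded.const _).mul (hw'.mul hDb))).integrable le_rfl) ?_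
        filter_upwards [hb] with ω h
        have := mul_le_mul_of_nonneg_left (exp_mul_le_cosh_add_sinh hc h u) (w0 ω)
        refine this.trans (le_of_eq ?_)
        ring
    _ = Real.cosh (u * c) * ∫ ω, w ω ∂P := by
        rw [integral_add (((EssBounded.const _).mul hw').integrable le_rfl)
          (((EssBounded.const _).mul (hw'.mul hDb)).integrable le_rfl), integral_const_mul,
          integral_const_mul, integral_mul_eq_zero_of_condExp_eq_zero hm hw hDb h0]
        simp
    _ ≤ _ := by
        refine mul_le_mul_of_nonneg_right ?_ (integral_nonneg w0)
        simpa [mul_pow] using Real.cosh_le_exp_half_sq (u * c)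

/-- The parameters of sub-Gaussian variables add up. -/
lemma IsSubG.add [IsFiniteMeasure P] (hm : m ≤ m₀) {A B : Ω → ℝ} {s t : ℝ} (hs : 0 < s)
    (ht : 0 < t) (hA : EssBounded P m₀ A) (hB : EssBounded P m₀ B) (hAs : IsSubG P m A s)
    (hBt : IsSubG P m B t) : IsSubG P m (fun ω => A ω + B ω) (s + t) := by
  intro w hw w0 u
  have hst : 0 < s + t := add_pos hs ht
  have hw' := hw.mono hm
  -- Convexity of exp with weights s/(s+t) and t/(s+t) separates A from B. The rescaled exponents a,
  -- b satisfy a s = b t = u (s+t), so both factors equal the target one. No dependence structure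
  -- between A and B enters.
  set a := u * (s + t) / s with ha
  set b := u * (s + t) / t with hb
  calc ∫ ω, w ω * Real.exp (u * (A ω + B ω)) ∂P
      ≤ ∫ ω, (s / (s + t) * (w ω * Real.exp (a * A ω))
          + t / (s + t) * (w ω * Real.exp (b * B ω))) ∂P := by
        refine integral_mono ((hw'.mul ((hA.add hB).exp u)).integrable le_rfl)
          ((((EssBounded.const _).mul (hw'.mul (hA.exp a))).add
            ((EssBounded.const _).mul (hw'.mul (hB.exp b)))).integrable le_rfl) ?_
        intro ω
        have h := convexOn_exp.2 (Set.mem_univ (a * A ω)) (Set.mem_univ (b * B ω))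
          (show 0 ≤ s / (s + t) by positivity) (show 0 ≤ t / (s + t) by positivity)
          (by field_simp)
        simp only [smul_eq_mul] at h
        have e : s / (s + t) * (a * A ω) + t / (s + t) * (b * B ω) = u * (A ω + B ω) := by
          rw [ha, hb]; field_simp
        rw [e] at h
        refine (mul_le_mul_of_nonneg_left h (w0 ω)).trans (le_of_eq ?_)
        ring
    _ = s / (s + t) * ∫ ω, w ω * Real.exp (a * A ω) ∂P
          + t / (s + t) * ∫ ω, w ω * Real.exp (b * B ω) ∂P := by
        rw [integral_add (((EssBounded.const _).mul (hw'.mul (hA.exp a))).integrable le_rfl)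
          (((EssBounded.const _).mul (hw'.mul (hB.exp b))).integrable le_rfl),
          integral_const_mul, integral_const_mul]
    _ ≤ s / (s + t) * (Real.exp (a ^ 2 * s ^ 2 / 2) * ∫ ω, w ω ∂P)
          + t / (s + t) * (Real.exp (b ^ 2 * t ^ 2 / 2) * ∫ ω, w ω ∂P) := by
        gcongr
        · exact hAs w hw w0 a
        · exact hBt w hw w0 b
    _ = _ := by
        have e1 : a ^ 2 * s ^ 2 / 2 = u ^ 2 * (s + t) ^ 2 / 2 := by rw [ha]; field_simp
        have e2 : b ^ 2 * t ^ 2 / 2 = u ^ 2 * (s + t) ^ 2 / 2 := by rw [hb]; field_simp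
        rw [e1, e2, ← add_mul]
        have : s / (s + t) + t / (s + t) = 1 := by field_simp
        rw [this, one_mul]

/-- The variance proxies of successive sub-Gaussian increments add up. -/
lemma IsSubG.concat (hmm : m ≤ m') {A B : Ω → ℝ} {s t r : ℝ}
    (hA : EssBounded P m' A) (hAs : IsSubG P m A s)
    (hBt : IsSubG P m' B t) (hr : r ^ 2 = s ^ 2 + t ^ 2) :
    IsSubG P m (fun ω => A ω + B ω) r := by
  intro w hw w0 u
  -- The weight w exp(uA) is itself admissible for `m'`. This is why sub-Gaussianity is tested
  -- against weights.
  have h1 := hBt _ ((hw.mono hmm).mul (hA.exp u)) (fun ω => mul_nonneg (w0 ω) (Real.exp_pos _).le) u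
  have h2 := hAs w hw w0 u
  calc ∫ ω, w ω * Real.exp (u * (A ω + B ω)) ∂P
      = ∫ ω, w ω * Real.exp (u * A ω) * Real.exp (u * B ω) ∂P := by
        congr 1; ext ω; rw [mul_add, Real.exp_add]; ring
    _ ≤ Real.exp (u ^ 2 * t ^ 2 / 2) * ∫ ω, w ω * Real.exp (u * A ω) ∂P := h1
    _ ≤ Real.exp (u ^ 2 * t ^ 2 / 2) * (Real.exp (u ^ 2 * s ^ 2 / 2) * ∫ ω, w ω ∂P) := by gcongr
    _ = _ := by
        rw [← mul_assoc, ← Real.exp_add, hr]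
        ring_nf

lemma IsSubG.congr {A B : Ω → ℝ} {s : ℝ} (hA : IsSubG P m A s) (h : A =ᵐ[P] B) :
    IsSubG P m B s := by
  intro w hw w0 u
  rw [← integral_congr_ae (f := fun ω => w ω * Real.exp (u * A ω))]
  · exact hA w hw w0 u
  · filter_upwards [h] with ω e
    simp [e]

end SubGaussian

/-! ### Dyadic martingale approximation -/

section Dyadic

variable {Ω : Type*} {m₀ : MeasurableSpace Ω} {P : Measure Ω}

/-- The sum of `x` over the dyadic block of length `2 ^ r` that follows `a`. -/
def blockSum (x : ℕ → Ω → ℝ) (a r : ℕ) (ω : Ω) : ℝ :=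
  ∑ i ∈ Finset.Ioc a (a + 2 ^ r), x i ω

/-- The sub-Gaussian parameter of a dyadic block of length `2 ^ r`, if `b n` bounds the conditional
expectation of the sum over a block of length `n`. -/
def blockParam (b : ℕ → ℝ) (r : ℕ) : ℝ :=
  √2 ^ r * (2 + √2 * ∑ k ∈ Finset.range r, b (2 ^ k) / √2 ^ k)

lemma blockParam_succ (b : ℕ → ℝ) (r : ℕ) :
    blockParam b (r + 1) = √2 * blockParam b r + 2 * b (2 ^ r) := by
  have h : (√2 : ℝ) ^ 2 = 2 := Real.sq_sqrt (by norm_num)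
  unfold blockParam
  rw [Finset.sum_range_succ, pow_succ]
  field_simp
  linear_combination (b (2 ^ r)) * h

lemma blockParam_pos {b : ℕ → ℝ} (hb : ∀ n, 0 ≤ b n) (r : ℕ) : 0 < blockParam b r := by
  unfold blockParam
  have : 0 ≤ ∑ k ∈ Finset.range r, b (2 ^ k) / √2 ^ k :=
    Finset.sum_nonneg fun k _ => div_nonneg (hb _) (by positivity)
  positivity

lemma blockSum_succ (x : ℕ → Ω → ℝ) (a r : ℕ) (ω : Ω) :
    blockSum x a (r + 1) ω = blockSum x a r ω + blockSum x (a + 2 ^ r) r ω := by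
  unfold blockSum
  rw [Finset.sum_Ioc_consecutive _ (Nat.le_add_right _ _) (Nat.le_add_right _ _)]
  congr 2
  rw [pow_succ]; ring

/-- Induction on the dyadic scale: the two centred halves combine by `IsSubG.concat`, the change of
conditioning of the second half is added by `IsSubG.add`, and the resulting recursion is
`blockParam_succ`. -/
theorem isSubG_blockSum [IsFiniteMeasure P] {G : ℕ → MeasurableSpace Ω} (hG : Monotone G)
    (hle : ∀ i, G i ≤ m₀) {x : ℕ → Ω → ℝ} (hx : ∀ i, StronglyMeasurable[G i] (x i))
    (hx1 : ∀ i ω, |x i ω| ≤ 1) {b : ℕ → ℝ} (hb : ∀ n, 0 ≤ b n) (hb' : ∀ k, 0 < b (2 ^ k))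
    (hcond : ∀ a r, ∀ᵐ ω ∂P, |(P[blockSum x a r | G a]) ω| ≤ b (2 ^ r)) (r a : ℕ) :
    IsSubG P (G a) (fun ω => blockSum x a r ω - (P[blockSum x a r | G a]) ω)
      (blockParam b r) := by
  have hS : ∀ r a, EssBounded P (G (a + 2 ^ r)) (blockSum x a r) := fun r a =>
    EssBounded.sum _ fun i hi =>
      ⟨(hx i).mono (hG (Finset.mem_Ioc.1 hi).2), 1, Filter.Eventually.of_forall (hx1 i)⟩
  have hS' : ∀ r a, EssBounded P m₀ (blockSum x a r) := fun r a => (hS r a).mono (hle _)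
  have hE : ∀ r a c, EssBounded P (G c) (P[blockSum x a r | G c]) := fun r a c =>
    (hS' r a).condExp
  induction r generalizing a with
  | zero =>
    have e : blockParam b 0 = 2 := by simp [blockParam]
    rw [e]
    have h1 : ∀ ω, |blockSum x a 0 ω| ≤ 1 := by intro ω; simpa [blockSum] using hx1 (a + 1) ω
    refine isSubG_of_bounded (hle a) (by norm_num)
      (((hS' 0 a).sub ((hE 0 a a).mono (hle a))).1) ?_ ?_
    · have h2 := ae_bdd_abs_condExp_of_ae_bdd_abs (μ := P) (m := G a)
        (Filter.Eventually.of_forall h1)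
      filter_upwards [h2] with ω h
      exact (abs_sub _ _).trans (by linarith [h1 ω])
    · have h3 := condExp_sub (μ := P) ((hS' 0 a).integrable le_rfl)
        ((hE 0 a a).integrable (hle a)) (G a)
      have h4 := condExp_of_stronglyMeasurable (μ := P) (hle a) (hE 0 a a).1
        ((hE 0 a a).integrable (hle a))
      refine h3.trans ?_
      rw [h4]
      simp
  | succ r ih =>
    rw [blockParam_succ]
    have hac : G a ≤ G (a + 2 ^ r) := hG (Nat.le_add_right _ _)
    have hA : EssBounded P (G (a + 2 ^ r))
        (fun ω => blockSum x a r ω - (P[blockSum x a r | G a]) ω) :=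
      (hS r a).sub ((hE r a a).mono hac)
    have hB : EssBounded P m₀ (fun ω => blockSum x (a + 2 ^ r) r ω
        - (P[blockSum x (a + 2 ^ r) r | G (a + 2 ^ r)]) ω) :=
      (hS' r _).sub ((hE r _ _).mono (hle _))
    have hD : EssBounded P m₀ (fun ω => (P[blockSum x (a + 2 ^ r) r | G (a + 2 ^ r)]) ω
        - (P[blockSum x (a + 2 ^ r) r | G a]) ω) :=
      ((hE r _ _).mono (hle _)).sub ((hE r _ _).mono (hle _))
    have hAB := IsSubG.concat (P := P) (r := √2 * blockParam b r) hac hA (ih a) (ih (a + 2 ^ r))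
      (by rw [mul_pow, Real.sq_sqrt (by norm_num)]; ring)
    have htower := condExp_condExp_of_le (μ := P) (f := blockSum x (a + 2 ^ r) r) hac
      (hle (a + 2 ^ r))
    -- The correction is centred given `G a` by the tower property. Each of its two terms is at most
    -- b(2^r): the first by hypothesis, the second because conditioning preserves the bound.
    have hDs : IsSubG P (G a) (fun ω => (P[blockSum x (a + 2 ^ r) r | G (a + 2 ^ r)]) ω
        - (P[blockSum x (a + 2 ^ r) r | G a]) ω) (2 * b (2 ^ r)) := by
      refine isSubG_of_bounded (hle a) (by linarith [hb' r]) hD.1 ?_ ?_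
      · have h1 := hcond (a + 2 ^ r) r
        have h2 := ae_bdd_abs_condExp_of_ae_bdd_abs (μ := P) (m := G a) h1
        filter_upwards [h1, h2, htower] with ω h1 h2 h3
        rw [h3] at h2
        exact (abs_sub _ _).trans (by linarith)
      · have h3 := condExp_sub (μ := P) ((hE r (a + 2 ^ r) (a + 2 ^ r)).integrable (hle _))
          ((hE r (a + 2 ^ r) a).integrable (hle a)) (G a)
        have h4 := condExp_of_stronglyMeasurable (μ := P) (hle a) (hE r (a + 2 ^ r) a).1
          ((hE r (a + 2 ^ r) a).integrable (hle a))
        rw [h4] at h3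
        refine h3.trans ?_
        filter_upwards [htower] with ω h
        simp [h]
    have hfin := IsSubG.add (hle a) (mul_pos (by positivity) (blockParam_pos hb r))
      (by linarith [hb' r]) ((hA.mono (hle _)).add hB) hD hAB hDs
    refine hfin.congr ?_
    have hadd := condExp_add (μ := P) ((hS' r a).integrable le_rfl)
      ((hS' r (a + 2 ^ r)).integrable le_rfl) (G a)
    have e : blockSum x a (r + 1) = blockSum x a r + blockSum x (a + 2 ^ r) r := by
      ext ω; exact blockSum_succ x a r ω
    filter_upwards [hadd] with ω h
    rw [e, h]
    simp only [Pi.add_apply]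
    ring

end Dyadic

/-! ### Sums of powers -/

section Sums

/-- `∑_{l ≤ n} l^(-α)`, the bound on the conditional expectation of a sum of `n` terms. -/
def mixSum (α : ℝ) (n : ℕ) : ℝ := ∑ l ∈ Finset.Icc 1 n, (l : ℝ) ^ (-α)

/-- `∑_{l ≥ 1} l^(-1/2-α)`. -/
def mixSeries (α : ℝ) : ℝ := ∑' j : ℕ, ((j : ℝ) + 1) ^ (-(1 / 2) - α)

/-- The partial sums of `mixSeries`. -/
def powSum (α : ℝ) (n : ℕ) : ℝ := ∑ l ∈ Finset.Icc 1 n, (l : ℝ) ^ (-(1 / 2) - α)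

lemma mixSum_nonneg (α : ℝ) (n : ℕ) : 0 ≤ mixSum α n :=
  Finset.sum_nonneg fun l _ => by positivity

lemma mixSum_two_pow_pos (α : ℝ) (k : ℕ) : 0 < mixSum α (2 ^ k) :=
  Finset.sum_pos (fun l hl => Real.rpow_pos_of_pos
    (by exact_mod_cast (Finset.mem_Icc.1 hl).1) _) ⟨1, by simp [Nat.one_le_two_pow]⟩

lemma summable_mixSeries {α : ℝ} (hα : 1 / 2 < α) :
    Summable fun j : ℕ => ((j : ℝ) + 1) ^ (-(1 / 2) - α) := by
  have h : Summable fun j : ℕ => (j : ℝ) ^ (-(1 / 2) - α) :=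
    Real.summable_nat_rpow.2 (by linarith)
  simpa using (summable_nat_add_iff 1).2 h

lemma sum_Icc_le_mixSeries {α : ℝ} (hα : 1 / 2 < α) (n : ℕ) :
    powSum α n ≤ mixSeries α := by
  have h := (summable_mixSeries hα).sum_le_tsum (Finset.range n) (fun j _ => by positivity)
  refine le_trans (le_of_eq ?_) h
  have e := Finset.sum_Ico_add' (fun j : ℕ => (j : ℝ) ^ (-(1 / 2) - α)) 0 n 1
  rw [Finset.range_eq_Ico, powSum]
  simp only [Nat.cast_add, Nat.cast_one, zero_add] at e
  rw [e]
  congr 1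

lemma one_le_mixSeries {α : ℝ} (hα : 1 / 2 < α) : 1 ≤ mixSeries α := by
  simpa [powSum] using sum_Icc_le_mixSeries hα 1

/-- For 2^k < l ≤ 2^(k+1), write l^(-α) = √l · l^(-1/2-α) and bound √l by √2^(k+1). -/
lemma mixSum_two_pow_succ_le (α : ℝ) (k : ℕ) :
    mixSum α (2 ^ (k + 1)) ≤ mixSum α (2 ^ k)
      + √2 ^ (k + 1) * (powSum α (2 ^ (k + 1))
        - powSum α (2 ^ k)) := by
  have hI : ∀ n, Finset.Icc 1 n = Finset.Ioc 0 n := fun n => by ext; simp; omega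
  have hle : 2 ^ k ≤ 2 ^ (k + 1) := Nat.pow_le_pow_right (by norm_num) (by omega)
  unfold mixSum powSum
  simp only [hI]
  rw [← Finset.sum_Ioc_consecutive _ (Nat.zero_le _) hle,
    ← Finset.sum_Ioc_consecutive (fun l : ℕ => (l : ℝ) ^ (-(1 / 2) - α)) (Nat.zero_le _) hle,
    add_sub_cancel_left, Finset.mul_sum]
  gcongr with l hl
  obtain ⟨h1, h2⟩ := Finset.mem_Ioc.1 hl
  have hl0 : (0 : ℝ) < l := by exact_mod_cast lt_of_le_of_lt (Nat.zero_le _) h1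
  have e : (l : ℝ) ^ (-α) = √l * (l : ℝ) ^ (-(1 / 2) - α) := by
    rw [Real.sqrt_eq_rpow, ← Real.rpow_add hl0]; congr 1; ring
  rw [e]
  gcongr
  have : √(l : ℝ) ≤ √((2 : ℝ) ^ (k + 1)) := Real.sqrt_le_sqrt (by exact_mod_cast h2)
  refine this.trans (le_of_eq ?_)
  rw [Real.sqrt_eq_iff_mul_self_eq (by positivity) (by positivity), ← mul_pow]
  norm_num

/-- The extra term 4β_n, with β_n = `mixSum α (2 ^ n) / √2 ^ n`, is a potential that closes the
induction. Since 1/√2 ≤ 3/4, the step β_{n+1} ≤ (3/4) β_n + increment turns β_n + 4β_{n+1} into at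
most 4β_n plus four increments. -/
lemma sum_mixSum_div_le {α : ℝ} (n : ℕ) :
    ∑ k ∈ Finset.range n, mixSum α (2 ^ k) / √2 ^ k + 4 * (mixSum α (2 ^ n) / √2 ^ n)
      ≤ 4 * powSum α (2 ^ n) := by
  induction n with
  | zero => simp [mixSum, powSum]
  | succ n ih =>
    rw [Finset.sum_range_succ]
    set β := mixSum α (2 ^ n) / √2 ^ n with hβ
    have hβ0 : 0 ≤ β := div_nonneg (mixSum_nonneg _ _) (by positivity)
    have h := mixSum_two_pow_succ_le α n
    have hs : (√2 : ℝ) ^ 2 = 2 := Real.sq_sqrt (by norm_num)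
    have hs1 : 1.4 ≤ √(2 : ℝ) := Real.le_sqrt_of_sq_le (by norm_num)
    have h2 : mixSum α (2 ^ (n + 1)) / √2 ^ (n + 1) ≤ β / √2
        + (powSum α (2 ^ (n + 1))
        - powSum α (2 ^ n)) := by
      rw [div_le_iff₀ (by positivity)]
      refine h.trans (le_of_eq ?_)
      rw [hβ, pow_succ]
      field_simp
    have h3 : β / √2 ≤ 3 / 4 * β := by
      rw [div_le_iff₀ (by positivity)]; nlinarith
    linarith

lemma mixSum_two_pow_le {α : ℝ} (hα : 1 / 2 < α) (n : ℕ) :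
    mixSum α (2 ^ n) ≤ √2 ^ n * mixSeries α := by
  have h := sum_mixSum_div_le (α := α) n
  have h0 : 0 ≤ ∑ k ∈ Finset.range n, mixSum α (2 ^ k) / √2 ^ k :=
    Finset.sum_nonneg fun k _ => div_nonneg (mixSum_nonneg _ _) (by positivity)
  have h1 := sum_Icc_le_mixSeries hα (2 ^ n)
  rw [← div_le_iff₀' (by positivity)]
  linarith

lemma blockParam_mixSum_le {α : ℝ} (hα : 1 / 2 < α) (r : ℕ) :
    blockParam (mixSum α) r ≤ √2 ^ r * (8 * mixSeries α) := by
  have h := sum_mixSum_div_le (α := α) r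
  have h0 : 0 ≤ mixSum α (2 ^ r) / √2 ^ r := div_nonneg (mixSum_nonneg _ _) (by positivity)
  have h1 := sum_Icc_le_mixSeries hα (2 ^ r)
  have h2 := one_le_mixSeries hα
  have hs1 : √(2 : ℝ) ≤ 1.5 := Real.sqrt_le_iff.2 (by norm_num)
  unfold blockParam
  gcongr
  have : √2 * ∑ k ∈ Finset.range r, mixSum α (2 ^ k) / √2 ^ k ≤ 1.5 * (4 * mixSeries α) := by
    have h3 : 0 ≤ ∑ k ∈ Finset.range r, mixSum α (2 ^ k) / √2 ^ k :=
      Finset.sum_nonneg fun k _ => div_nonneg (mixSum_nonneg _ _) (by positivity)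
    exact mul_le_mul hs1 (by linarith) h3 (by norm_num)
  linarith

end Sums

/-! ### A concentration inequality under weak mixing -/

section Concentration

variable {Ω : Type*} {m₀ : MeasurableSpace Ω} {P : Measure Ω}

lemma abs_condExp_blockSum_le [IsFiniteMeasure P] {G : ℕ → MeasurableSpace Ω}
    {x : ℕ → Ω → ℝ} (hxi : ∀ i, Integrable (x i) P) {α : ℝ}
    (hcond : ∀ a t, 1 ≤ t → ∀ᵐ ω ∂P, |(P[x (a + t) | G a]) ω| ≤ (t : ℝ) ^ (-α)) (a r : ℕ) :
    ∀ᵐ ω ∂P, |(P[blockSum x a r | G a]) ω| ≤ mixSum α (2 ^ r) := by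
  have e : blockSum x a r = ∑ t ∈ Finset.Icc 1 (2 ^ r), x (a + t) := by
    ext ω
    rw [blockSum, Finset.sum_apply]
    refine (Finset.sum_bij (fun t _ => a + t) ?_ ?_ ?_ ?_).symm
    · intro t ht; simp only [Finset.mem_Icc, Finset.mem_Ioc] at *; omega
    · intro t _ t' _ h; exact Nat.add_left_cancel h
    · intro i hi
      simp only [Finset.mem_Ioc] at hi
      exact ⟨i - a, by simp only [Finset.mem_Icc]; omega, by omega⟩
    · intros; rfl
  have h1 := condExp_finsetSum (μ := P) (s := Finset.Icc 1 (2 ^ r)) (f := fun t => x (a + t))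
    (fun t _ => hxi _) (G a)
  have h2 : ∀ᵐ ω ∂P, ∀ t ∈ Finset.Icc 1 (2 ^ r),
      |(P[x (a + t) | G a]) ω| ≤ (t : ℝ) ^ (-α) := by
    rw [Finset.eventually_all]
    exact fun t ht => hcond a t (Finset.mem_Icc.1 ht).1
  rw [e]
  filter_upwards [h1, h2] with ω h1 h2
  rw [h1, Finset.sum_apply]
  exact (Finset.abs_sum_le_sum_abs _ _).trans (Finset.sum_le_sum h2)

/-- Chernoff's bound with the indicator of H as weight. The sum is centred only up to its
conditional expectation, a drift of order √n, which the factor 80 in M also covers. -/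
theorem measureReal_blockSum_ge_le [IsProbabilityMeasure P] {G : ℕ → MeasurableSpace Ω}
    (hG : Monotone G) (hle : ∀ i, G i ≤ m₀) {x : ℕ → Ω → ℝ}
    (hx : ∀ i, StronglyMeasurable[G i] (x i)) (hx1 : ∀ i ω, |x i ω| ≤ 1) {α : ℝ} (hα : 1 / 2 < α)
    (hcond : ∀ a t, 1 ≤ t → ∀ᵐ ω ∂P, |(P[x (a + t) | G a]) ω| ≤ (t : ℝ) ^ (-α))
    {H : Set Ω} (hH : MeasurableSet[G 0] H) {n r : ℕ} (hn : 1 ≤ n) (hr : 2 ^ r ≤ 2 * n)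
    {M l : ℝ} (hM : 80 * mixSeries α ≤ M) (hl : 1 ≤ l) :
    P.real (H ∩ {ω | √n * ((1 + M) * √(2 * l)) ≤ blockSum x 0 r ω})
      ≤ Real.exp (-l) * P.real H := by
  set Z := mixSeries α with hZ
  have hZ1 : 1 ≤ Z := one_le_mixSeries hα
  have hn0 : (0 : ℝ) < n := by exact_mod_cast hn
  set X := √n * ((1 + M) * √(2 * l)) with hX
  set S := blockSum x 0 r with hS
  set E := P[S | G 0] with hE
  have hxi : ∀ i, Integrable (x i) P := fun i =>
    Integrable.of_bound ((hx i).mono (hle i)).aestronglyMeasurable 1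
      (Filter.Eventually.of_forall (by simpa using hx1 i))
  have hblock := abs_condExp_blockSum_le hxi hcond
  have hsub := isSubG_blockSum (P := P) hG hle hx hx1 (mixSum_nonneg α) (mixSum_two_pow_pos α)
    hblock r 0
  have hSb : EssBounded P m₀ S := EssBounded.sum _ fun i _ =>
    ⟨(hx i).mono (hle i), 1, Filter.Eventually.of_forall (hx1 i)⟩
  have hEb : EssBounded P m₀ E := (hSb.condExp (m := G 0)).mono (hle 0)
  -- With this u the moment generating function costs at most exp(64 l), while the threshold minus
  -- the drift gains at least exp(65 l). The net factor is exp(-l).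
  set u := √l / (√n * Z) with hu
  have hu0 : 0 < u := by positivity
  have hw : EssBounded P (G 0) (H.indicator 1) := by
    refine ⟨stronglyMeasurable_one.indicator hH, 1, Filter.Eventually.of_forall fun ω => ?_⟩
    by_cases h : ω ∈ H <;> simp [h]
  have hmgf := hsub _ hw (fun ω => Set.indicator_nonneg (by simp) ω) u
  have hHm : MeasurableSet H := hle 0 H hH
  rw [integral_indicator_one hHm] at hmgf
  have hev : MeasurableSet (H ∩ {ω | X ≤ S ω}) :=
    hHm.inter (measurableSet_le measurable_const hSb.1.measurable)
  have hb : √(2 ^ r : ℝ) ≤ √2 * √n := by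
    rw [← Real.sqrt_mul (by norm_num)]
    exact Real.sqrt_le_sqrt (by exact_mod_cast hr)
  have hpow : √(2 : ℝ) ^ r = √(2 ^ r : ℝ) := by
    symm
    rw [Real.sqrt_eq_iff_mul_self_eq (by positivity) (by positivity), ← mul_pow]
    norm_num
  have hlow : P.real (H ∩ {ω | X ≤ S ω}) * Real.exp (u * (X - √2 * √n * Z))
      ≤ ∫ ω, H.indicator 1 ω * Real.exp (u * (S ω - E ω)) ∂P := by
    rw [← integral_indicator_one hev, ← integral_mul_const]
    refine integral_mono_ae ?_ (((hw.mono (hle 0)).mul ((hSb.sub hEb).exp u)).integrable le_rfl) ?_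
    · exact ((integrable_const (1 : ℝ)).indicator hev).mul_const _
    · filter_upwards [hblock 0 r] with ω h
      by_cases hω : ω ∈ H ∩ {ω | X ≤ S ω}
      · have hωH : ω ∈ H := hω.1
        have hωX : X ≤ S ω := hω.2
        rw [Set.indicator_of_mem hω, Set.indicator_of_mem hωH]
        simp only [Pi.one_apply, one_mul]
        have h1 : E ω ≤ √2 * √n * Z := by
          refine (le_abs_self _).trans (h.trans ((mixSum_two_pow_le hα r).trans ?_))
          rw [hpow]
          gcongr
        gcongr
      · rw [Set.indicator_of_notMem hω, zero_mul]
        exact mul_nonneg (Set.indicator_nonneg (by simp) ω) (Real.exp_pos _).le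
  have hparam : u ^ 2 * blockParam (mixSum α) r ^ 2 / 2 ≤ 64 * l := by
    have h1 := blockParam_mixSum_le hα r
    have h2 := (blockParam_pos (mixSum_nonneg α) r).le
    have h3 : blockParam (mixSum α) r ≤ √2 * √n * (8 * Z) :=
      h1.trans (by rw [hpow]; gcongr)
    have h4 : u * blockParam (mixSum α) r ≤ √l * (√2 * 8) := by
      calc u * blockParam (mixSum α) r ≤ u * (√2 * √n * (8 * Z)) := by gcongr
        _ = √l * (√2 * 8) := by rw [hu]; field_simp
    have h5 : (u * blockParam (mixSum α) r) ^ 2 ≤ (√l * (√2 * 8)) ^ 2 := by gcongr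
    rw [mul_pow, mul_pow, Real.sq_sqrt (by linarith), mul_pow, Real.sq_sqrt (by norm_num)] at h5
    linarith
  have hexp : 64 * l + l ≤ u * (X - √2 * √n * Z) := by
    have h1 : u * (X - √2 * √n * Z) = √l * √2 * ((1 + M) / Z * √l - 1) := by
      rw [hu, hX, Real.sqrt_mul (by norm_num)]
      field_simp
    have h2 : 80 ≤ (1 + M) / Z := by
      rw [le_div_iff₀ (by linarith)]; linarith
    have h3 : 1 ≤ √l := Real.one_le_sqrt.2 hl
    have h4 : 1.4 ≤ √(2 : ℝ) := Real.le_sqrt_of_sq_le (by norm_num)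
    have h5 : √l * √l = l := Real.mul_self_sqrt (by linarith)
    rw [h1]
    calc 64 * l + l ≤ √l * 1.4 * (80 * √l - 1) := by nlinarith
      _ ≤ √l * √2 * ((1 + M) / Z * √l - 1) := by
        gcongr
        nlinarith
  have hP0 : 0 ≤ P.real H := measureReal_nonneg
  have hQ0 : 0 ≤ P.real (H ∩ {ω | X ≤ S ω}) := measureReal_nonneg
  have hfin : P.real (H ∩ {ω | X ≤ S ω}) * Real.exp (64 * l + l)
      ≤ Real.exp (64 * l) * P.real H :=
    calc _ ≤ P.real (H ∩ {ω | X ≤ S ω}) * Real.exp (u * (X - √2 * √n * Z)) := by gcongr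
      _ ≤ _ := hlow.trans hmgf
      _ ≤ _ := by gcongr
  have h6 := mul_le_mul_of_nonneg_right hfin (Real.exp_pos (-(64 * l + l))).le
  rw [mul_assoc, ← Real.exp_add, add_neg_cancel, Real.exp_zero, mul_one] at h6
  refine h6.trans (le_of_eq ?_)
  rw [mul_right_comm, ← Real.exp_add]
  congr 2
  ring

/-- Increasing enumeration of J, continued beyond J so that it is strictly monotone on all of ℕ and
composes with a filtration. -/
lemma exists_strictMono_sum_range (J : Finset ℕ) :
    ∃ g : ℕ → ℕ, StrictMono g ∧ (∀ i < J.card, g i ∈ J)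
      ∧ ∀ f : ℕ → ℝ, ∑ i ∈ Finset.range J.card, f (g i) = ∑ j ∈ J, f j := by
  set n := J.card with hn
  set e := J.orderEmbOfFin hn.symm
  refine ⟨fun i => if h : i < n then e ⟨i, h⟩ else J.sup id + 1 + i, ?_, ?_, ?_⟩
  · intro i j hij
    have hmem : ∀ i (h : i < n), e ⟨i, h⟩ ≤ J.sup id := fun i h =>
      Finset.le_sup (f := id) (J.orderEmbOfFin_mem hn.symm ⟨i, h⟩)
    by_cases hj : j < n
    · have hi : i < n := hij.trans hj
      simp only [hi, hj, dif_pos]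
      exact e.strictMono (by simpa using hij)
    · by_cases hi : i < n
      · simp only [hi, hj, dif_pos, dif_neg, not_false_eq_true]
        have := hmem i hi
        omega
      · simp only [hi, hj, dif_neg, not_false_eq_true]
        omega
  · intro i hi
    simp only [hi, dif_pos]
    exact J.orderEmbOfFin_mem hn.symm ⟨i, hi⟩
  · intro f
    rw [Finset.sum_range]
    simp only [Fin.is_lt, dif_pos, Fin.eta]
    conv_rhs => rw [← J.map_orderEmbOfFin_univ hn.symm]
    rw [Finset.sum_map]
    rfl

lemma exists_two_pow_between {n : ℕ} (hn : 1 ≤ n) : ∃ r, n ≤ 2 ^ r ∧ 2 ^ r ≤ 2 * n := by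
  refine ⟨Nat.log 2 n + 1, (Nat.lt_pow_succ_log_self (by norm_num) n).le, ?_⟩
  rw [pow_succ]
  have := Nat.pow_log_le_self 2 (by omega : n ≠ 0)
  omega

/-- A sub-Gaussian tail bound for the sum of the bounded variables `Y j`, `j ∈ J`, conditionally on
the history up to a time `τ` before `J`, if the conditional expectation of `Y j` given the history
up to the time `i` decays like `(j - i) ^ (-α)`. -/
theorem measureReal_sum_ge_le [IsProbabilityMeasure P] {F : ℕ → MeasurableSpace Ω}
    (hF : Monotone F) (hle : ∀ i, F i ≤ m₀) {τ : ℕ} {J : Finset ℕ} (hJ : ∀ j ∈ J, τ < j)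
    {Y : ℕ → Ω → ℝ} (hY : ∀ j ∈ J, StronglyMeasurable[F j] (Y j)) (hY1 : ∀ j ω, |Y j ω| ≤ 1)
    {α : ℝ} (hα : 1 / 2 < α)
    (hmix : ∀ i j, τ ≤ i → j ∈ J → i < j →
      ∀ᵐ ω ∂P, |(P[Y j | F i]) ω| ≤ ((j - i : ℕ) : ℝ) ^ (-α))
    {H : Set Ω} (hH : MeasurableSet[F τ] H) (hn : 1 ≤ J.card)
    {M l : ℝ} (hM : 80 * mixSeries α ≤ M) (hl : 1 ≤ l) :
    P.real (H ∩ {ω | √(J.card : ℝ) * ((1 + M) * √(2 * l)) ≤ ∑ j ∈ J, Y j ω})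
      ≤ Real.exp (-l) * P.real H := by
  obtain ⟨g, hg, hgJ, hsum⟩ := exists_strictMono_sum_range J
  obtain ⟨r, hr1, hr2⟩ := exists_two_pow_between hn
  set n := J.card with hnJ
  set g' : ℕ → ℕ := fun i => if i = 0 then τ else g (i - 1) with hg'
  have hτ : τ < g 0 := hJ _ (hgJ 0 hn)
  have hg'm : StrictMono g' := by
    refine strictMono_nat_of_lt_succ fun i => ?_
    rcases Nat.eq_zero_or_pos i with rfl | hi
    · simpa [hg'] using hτ
    · simp only [hg', hi.ne', if_false, Nat.succ_ne_zero, Nat.add_sub_cancel]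
      exact hg (by omega)
  -- Padding with zeros up to a power of two, which is at most 2n.
  set x : ℕ → Ω → ℝ := fun i => if i = 0 ∨ n < i then 0 else Y (g' i) with hx
  have hcond : ∀ a t, 1 ≤ t → ∀ᵐ ω ∂P, |(P[x (a + t) | F (g' a)]) ω| ≤ (t : ℝ) ^ (-α) := by
    intro a t ht
    by_cases h : n < a + t
    · have : x (a + t) = 0 := by simp [hx, h]
      rw [this, condExp_zero]
      refine Filter.Eventually.of_forall fun ω => ?_
      simp only [Pi.zero_apply, abs_zero]
      positivity
    · have e : x (a + t) = Y (g' (a + t)) := by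
        have : ¬ (a + t = 0 ∨ n < a + t) := by omega
        simp only [hx, this, if_false]
      have hmem : g' (a + t) ∈ J := by
        have : a + t ≠ 0 := by omega
        simp only [hg', this, if_false]
        exact hgJ _ (by omega)
      have h0 : τ ≤ g' a := by
        have := hg'm.monotone (Nat.zero_le a)
        simpa [hg'] using this
      have hgap : t ≤ g' (a + t) - g' a := by
        have : ∀ t, g' a + t ≤ g' (a + t) := by
          intro t
          induction t with
          | zero => simp
          | succ t ih =>
            have := hg'm (show a + t < a + (t + 1) by omega)
            omega
        have := this t
        omega
      have hm := hmix (g' a) (g' (a + t)) h0 hmem (hg'm (by omega))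
      rw [e]
      filter_upwards [hm] with ω hm
      refine hm.trans ?_
      -- The true time lag is at least the index lag t, and l ↦ l^(-α) decreases.
      exact Real.rpow_le_rpow_of_nonpos (by exact_mod_cast ht) (by exact_mod_cast hgap)
        (by linarith)
  have hfin := measureReal_blockSum_ge_le (P := P) (G := fun i => F (g' i))
    (fun i j hij => hF (hg'm.monotone hij)) (fun i => hle _) (x := x)
    (fun i => by
      by_cases h : i = 0 ∨ n < i
      · simp only [hx, h, if_true]; exact stronglyMeasurable_zero
      · have hi : i ≠ 0 ∧ i - 1 < n := by omega
        simp only [hx, h, if_false]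
        exact hY _ (by simpa only [hg', hi.1, if_false] using hgJ _ hi.2))
    (fun i ω => by
      by_cases h : i = 0 ∨ n < i
      · simp [hx, h]
      · simp only [hx, h, if_false]; exact hY1 _ ω) hα hcond (H := H)
    (by simpa [hg'] using hH) hn hr2 hM hl
  have hS : ∀ ω, blockSum x 0 r ω = ∑ j ∈ J, Y j ω := by
    intro ω
    rw [← hsum fun j => Y j ω, blockSum, zero_add]
    have e1 : ∑ i ∈ Finset.Ioc 0 (2 ^ r), x i ω = ∑ i ∈ Finset.Ioc 0 n, x i ω := by
      symm
      refine Finset.sum_subset (fun i hi => ?_) fun i _ hi => ?_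
      · simp only [Finset.mem_Ioc] at *; omega
      · have : i = 0 ∨ n < i := by simp only [Finset.mem_Ioc] at hi; omega
        simp [hx, this]
    rw [e1]
    refine (Finset.sum_bij (fun i _ => i + 1) ?_ ?_ ?_ ?_).symm
    · intro i hi; simp only [Finset.mem_range, Finset.mem_Ioc] at *; omega
    · intro i _ j _ h; exact Nat.add_right_cancel h
    · intro i hi
      simp only [Finset.mem_Ioc] at hi
      exact ⟨i - 1, by simp only [Finset.mem_range]; omega, by omega⟩
    · intro i hi
      have h : ¬ (i + 1 = 0 ∨ n < i + 1) := by simp only [Finset.mem_range] at hi; omega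
      simp only [Nat.succ_ne_zero, false_or] at h
      simp only [hx, h, if_false, hg', Nat.succ_ne_zero, Nat.add_sub_cancel, or_self]
  simpa only [hS] using hfin

end Concentration

/-! ### The parameters of the epochs -/

section Parameters

variable {M : ℝ} {T s : ℕ}

lemma half_pow_sq_eq (s : ℕ) : ((1 / 2 : ℝ) ^ s) ^ 2 = ((4 : ℝ) ^ s)⁻¹ := by
  rw [← pow_mul, mul_comm, pow_mul, ← inv_pow]; norm_num

lemma logTerm_eq (T s : ℕ) :
    logTerm T s = Real.log (4 * √(Real.exp 1) * (T / (4 : ℝ) ^ s)) := by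
  rw [logTerm, half_pow_sq_eq, ← div_eq_mul_inv, mul_div_assoc]

lemma numPulls_eq (M : ℝ) (T s : ℕ) :
    numPulls M T s = ⌈8 * (1 + M) ^ 2 * logTerm T s * (4 : ℝ) ^ s⌉₊ := by
  rw [numPulls, half_pow_sq_eq, div_inv_eq_mul]

lemma four_pow_le (hT : 1 ≤ T) (hs : s ≤ Nat.log 4 T) : (4 : ℝ) ^ s ≤ T := by
  have h := (Nat.pow_le_pow_right (by norm_num : 0 < 4) hs).trans
    (Nat.pow_log_le_self 4 (by omega : T ≠ 0))
  exact_mod_cast h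

lemma one_le_logTerm (hT : 1 ≤ T) (hs : s ≤ Nat.log 4 T) : 1 ≤ logTerm T s := by
  have h4 := four_pow_le hT hs
  have h1 : (1 : ℝ) ≤ T / (4 : ℝ) ^ s := by rwa [le_div_iff₀ (by positivity), one_mul]
  have he : Real.exp 1 ≤ 16 := Real.exp_one_lt_d9.le.trans (by norm_num)
  have hs4 : √(Real.exp 1) ≤ 4 := Real.sqrt_le_iff.2 ⟨by norm_num, by linarith⟩
  have hsq : √(Real.exp 1) * √(Real.exp 1) = Real.exp 1 := Real.mul_self_sqrt (Real.exp_pos 1).le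
  rw [logTerm_eq, Real.le_log_iff_exp_le (by positivity)]
  have h0 : 0 ≤ √(Real.exp 1) := Real.sqrt_nonneg _
  nlinarith [mul_nonneg h0 (sub_nonneg.2 h1)]

lemma exp_neg_logTerm_le (hT : 1 ≤ T) (s : ℕ) : Real.exp (-logTerm T s) ≤ (4 : ℝ) ^ s / T := by
  have hT0 : (0 : ℝ) < T := by exact_mod_cast hT
  have hsq : 1 ≤ √(Real.exp 1) := Real.one_le_sqrt.2 (Real.one_le_exp (by norm_num))
  rw [Real.exp_neg, logTerm_eq, Real.exp_log (by positivity),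
    inv_le_comm₀ (by positivity) (by positivity), inv_div]
  exact le_mul_of_one_le_left (by positivity) (by linarith)

lemma numPulls_ge (M : ℝ) (T s : ℕ) :
    8 * (1 + M) ^ 2 * logTerm T s * (4 : ℝ) ^ s ≤ numPulls M T s := by
  rw [numPulls_eq]; exact Nat.le_ceil _

lemma one_le_pulls_aux (hM : 0 ≤ M) (hT : 1 ≤ T) (hs : s ≤ Nat.log 4 T) :
    8 * (4 : ℝ) ^ s ≤ 8 * (1 + M) ^ 2 * logTerm T s * (4 : ℝ) ^ s := by
  have hL := one_le_logTerm hT hs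
  have h1 : 1 ≤ (1 + M) ^ 2 := one_le_pow₀ (by linarith)
  have : 1 ≤ (1 + M) ^ 2 * logTerm T s := one_le_mul_of_one_le_of_one_le h1 hL
  have h4 : (0 : ℝ) < (4 : ℝ) ^ s := by positivity
  nlinarith

lemma numPulls_le (hM : 0 ≤ M) (hT : 1 ≤ T) (hs : s ≤ Nat.log 4 T) :
    (numPulls M T s : ℝ) ≤ 16 * (1 + M) ^ 2 * (logTerm T s * (4 : ℝ) ^ s) := by
  have h := one_le_pulls_aux hM hT hs
  have h4 : (1 : ℝ) ≤ (4 : ℝ) ^ s := one_le_pow₀ (by norm_num)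
  rw [numPulls_eq]
  have := (Nat.ceil_lt_add_one (show 0 ≤ 8 * (1 + M) ^ 2 * logTerm T s * (4 : ℝ) ^ s by
    linarith)).le
  linarith

lemma numPulls_pos (hM : 0 ≤ M) (hT : 1 ≤ T) (hs : s ≤ Nat.log 4 T) : 0 < numPulls M T s := by
  have h := (one_le_pulls_aux hM hT hs).trans (numPulls_ge M T s)
  have h4 : (0 : ℝ) < (4 : ℝ) ^ s := by positivity
  exact_mod_cast (show (0 : ℝ) < numPulls M T s by linarith)

/-- Here n_s ≥ 8 · 4^s > T at s = log₄ T, so a single arm exhausts the horizon and no later epoch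
matters. -/
lemma le_numPulls_log (hM : 0 ≤ M) (hT : 1 ≤ T) : T ≤ numPulls M T (Nat.log 4 T) := by
  have h := (one_le_pulls_aux hM hT le_rfl).trans (numPulls_ge M T _)
  have h1 := Nat.lt_pow_succ_log_self (by norm_num : 1 < 4) T
  have h2 : (T : ℝ) < (4 : ℝ) ^ (Nat.log 4 T) * 4 := by
    rw [← pow_succ]; exact_mod_cast h1
  have h4 : (0 : ℝ) < (4 : ℝ) ^ Nat.log 4 T := by positivity
  exact_mod_cast (show (T : ℝ) ≤ numPulls M T (Nat.log 4 T) by linarith)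

lemma radius_pos (hM : 0 ≤ M) (hT : 1 ≤ T) (hs : s ≤ Nat.log 4 T) : 0 < radius M T s := by
  have hL := one_le_logTerm hT hs
  have hn : (0 : ℝ) < numPulls M T s := by exact_mod_cast numPulls_pos hM hT hs
  unfold radius
  positivity

lemma radius_le (hM : 0 ≤ M) (hT : 1 ≤ T) (hs : s ≤ Nat.log 4 T) :
    radius M T s ≤ (1 / 2 : ℝ) ^ s / 2 := by
  have hL := one_le_logTerm hT hs
  have hn : (0 : ℝ) < numPulls M T s := by exact_mod_cast numPulls_pos hM hT hs
  have h := numPulls_ge M T s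
  have hM1 : 0 < 1 + M := by linarith
  unfold radius
  rw [← le_div_iff₀' hM1]
  refine Real.sqrt_le_iff.2 ⟨by positivity, ?_⟩
  rw [div_pow, div_pow, half_pow_sq_eq, div_le_iff₀ hn]
  have h4 : (0 : ℝ) < (4 : ℝ) ^ s := by positivity
  calc 2 * logTerm T s
      = ((4 : ℝ) ^ s)⁻¹ / 2 ^ 2 / (1 + M) ^ 2 * (8 * (1 + M) ^ 2 * logTerm T s * (4 : ℝ) ^ s) := by
        field_simp; norm_num
    _ ≤ _ := by gcongr

lemma numPulls_mul_radius (hM : 0 ≤ M) (hT : 1 ≤ T) (hs : s ≤ Nat.log 4 T) :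
    numPulls M T s * radius M T s
      = √(numPulls M T s : ℝ) * ((1 + M) * √(2 * logTerm T s)) := by
  have hn : (0 : ℝ) < numPulls M T s := by exact_mod_cast numPulls_pos hM hT hs
  rw [radius, Real.sqrt_div' _ hn.le]
  have h : √(numPulls M T s : ℝ) * √(numPulls M T s : ℝ) = numPulls M T s :=
    Real.mul_self_sqrt hn.le
  have h0 : √(numPulls M T s : ℝ) ≠ 0 := (Real.sqrt_pos.2 hn).ne'
  nth_rewrite 1 [← h]
  field_simp

/-- The largest selected power is at most c, and the smaller powers add at most a factor q/(q-1).
The bound does not depend on N, and p may have holes. -/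
lemma sum_filter_pow_le {q c : ℝ} (hq : 1 < q) (hc : 0 ≤ c) (p : ℕ → Prop) [DecidablePred p]
    (hp : ∀ s, p s → q ^ s ≤ c) (N : ℕ) :
    ∑ s ∈ (Finset.range N).filter p, q ^ s ≤ c * (q / (q - 1)) := by
  have hq1 : 0 < q - 1 := by linarith
  have hA : ∀ N, ∑ s ∈ (Finset.range N).filter p, q ^ s ≤ q ^ N / (q - 1) := by
    intro N
    refine (Finset.sum_le_sum_of_subset_of_nonneg (Finset.filter_subset _ _)
      fun _ _ _ => by positivity).trans ?_
    rw [geom_sum_eq hq.ne']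
    gcongr
    linarith
  induction N with
  | zero => simp; positivity
  | succ N ih =>
    by_cases h : p N
    · rw [Finset.range_add_one, Finset.filter_insert, if_pos h, Finset.sum_insert (by simp)]
      have h1 := hA N
      have h2 := hp N h
      calc q ^ N + _ ≤ q ^ N + q ^ N / (q - 1) := by gcongr
        _ = q ^ N * (q / (q - 1)) := by field_simp; ring
        _ ≤ _ := by gcongr
    · rwa [Finset.range_add_one, Finset.filter_insert, if_neg h]

lemma half_pow_eq (s : ℕ) : (1 / 2 : ℝ) ^ s = ((2 : ℝ) ^ s)⁻¹ := by
  rw [← inv_pow]; norm_num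

lemma two_pow_le_of_lt {d : ℝ} (hd : 0 < d) {s : ℕ} (h : d < 4 * (1 / 2 : ℝ) ^ s) :
    (2 : ℝ) ^ s ≤ 4 / d := by
  rw [half_pow_eq, ← div_eq_mul_inv, lt_div_iff₀ (by positivity)] at h
  rw [le_div_iff₀ hd]
  linarith

/-- The total number of pulls of an arm with gap `d` in the epochs in which `d < 4 θ_s`. -/
lemma sum_numPulls_le (hM : 0 ≤ M) (hT : 1 ≤ T) {d : ℝ} (hd : 0 < d)
    (hl : -1 ≤ Real.log (T * d ^ 2)) :
    ∑ s ∈ (Finset.range (Nat.log 4 T + 1)).filter (fun s => d < 4 * (1 / 2 : ℝ) ^ s),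
        (numPulls M T s : ℝ)
      ≤ 16 * (1 + M) ^ 2 * ((96 + 32 * Real.log (T * d ^ 2)) / d ^ 2) := by
  set l := Real.log (T * d ^ 2) with hldef
  have hT0 : (0 : ℝ) < T := by exact_mod_cast hT
  have h4e : Real.log (4 * √(Real.exp 1)) ≤ 2 := by
    rw [Real.log_mul (by norm_num) (by positivity), Real.log_sqrt (Real.exp_pos 1).le,
      Real.log_exp]
    have : Real.log 4 = 2 * Real.log 2 := by
      rw [show (4 : ℝ) = 2 ^ 2 by norm_num, Real.log_pow]; norm_num
    have := Real.log_two_lt_d9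
    linarith
  -- Write T/4^s = T d² · (1/(d 2^s))² and use log y ≤ y on the last factor together with log(4√e) ≤
  -- 2. The logarithm no longer depends on s, and only geometric sums of 4^s and 2^s remain.
  have hterm : ∀ s, logTerm T s * (4 : ℝ) ^ s ≤ (l + 2) * (4 : ℝ) ^ s + 2 / d * (2 : ℝ) ^ s := by
    intro s
    have h2 : (0 : ℝ) < (2 : ℝ) ^ s := by positivity
    have h42 : (4 : ℝ) ^ s = (2 : ℝ) ^ s * (2 : ℝ) ^ s := by rw [← mul_pow]; norm_num
    have e : 4 * √(Real.exp 1) * (T / (4 : ℝ) ^ s)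
        = 4 * √(Real.exp 1) * (T * d ^ 2) * (1 / (d * (2 : ℝ) ^ s)) ^ 2 := by
      rw [h42]; field_simp
    have hlog : Real.log (1 / (d * (2 : ℝ) ^ s)) ≤ 1 / (d * (2 : ℝ) ^ s) :=
      (Real.log_le_sub_one_of_pos (by positivity)).trans (by linarith)
    have : logTerm T s ≤ (l + 2) + 2 * (1 / (d * (2 : ℝ) ^ s)) := by
      rw [logTerm_eq, e, Real.log_mul (by positivity) (by positivity),
        Real.log_mul (by positivity) (by positivity), Real.log_pow]
      push_cast
      linarith
    calc logTerm T s * (4 : ℝ) ^ s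
        ≤ ((l + 2) + 2 * (1 / (d * (2 : ℝ) ^ s))) * (4 : ℝ) ^ s := by gcongr
      _ = _ := by rw [h42]; field_simp
  have hp : ∀ s : ℕ, d < 4 * (1 / 2 : ℝ) ^ s → (2 : ℝ) ^ s ≤ 4 / d := fun s hs =>
    two_pow_le_of_lt hd hs
  have hp4 : ∀ s : ℕ, d < 4 * (1 / 2 : ℝ) ^ s → (4 : ℝ) ^ s ≤ 16 / d ^ 2 := fun s hs => by
    have e : (4 : ℝ) ^ s = ((2 : ℝ) ^ s) ^ 2 := by rw [← pow_mul, mul_comm, pow_mul]; norm_num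
    have := pow_le_pow_left₀ (by positivity) (hp s hs) 2
    rw [e]
    refine this.trans (le_of_eq ?_)
    rw [div_pow]; norm_num
  have h2 := sum_filter_pow_le (q := 2) (by norm_num) (by positivity) _ hp (Nat.log 4 T + 1)
  have h4 := sum_filter_pow_le (q := 4) (by norm_num) (by positivity) _ hp4 (Nat.log 4 T + 1)
  have hl2 : 0 ≤ l + 2 := by linarith
  calc _ ≤ ∑ s ∈ (Finset.range (Nat.log 4 T + 1)).filter (fun s => d < 4 * (1 / 2 : ℝ) ^ s),
        16 * (1 + M) ^ 2 * ((l + 2) * (4 : ℝ) ^ s + 2 / d * (2 : ℝ) ^ s) := by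
        refine Finset.sum_le_sum fun s hs => ?_
        have hs' : s ≤ Nat.log 4 T := by
          have := Finset.mem_range.1 (Finset.mem_filter.1 hs).1
          omega
        refine (numPulls_le hM hT hs').trans ?_
        gcongr
        exact hterm s
    _ = 16 * (1 + M) ^ 2 * ((l + 2) * ∑ s ∈ (Finset.range (Nat.log 4 T + 1)).filter
          (fun s => d < 4 * (1 / 2 : ℝ) ^ s), (4 : ℝ) ^ s + 2 / d *
          ∑ s ∈ (Finset.range (Nat.log 4 T + 1)).filter (fun s => d < 4 * (1 / 2 : ℝ) ^ s),
            (2 : ℝ) ^ s) := by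
        rw [← Finset.mul_sum, Finset.sum_add_distrib, ← Finset.mul_sum, ← Finset.mul_sum]
    _ ≤ 16 * (1 + M) ^ 2 * ((l + 2) * (16 / d ^ 2 * (4 / (4 - 1)))
          + 2 / d * (4 / d * (2 / (2 - 1)))) := by gcongr
    _ ≤ _ := by
        gcongr
        have e : (l + 2) * (16 / d ^ 2 * (4 / (4 - 1))) + 2 / d * (4 / d * (2 / (2 - 1)))
          = ((l + 2) * (64 / 3) + 16) / d ^ 2 := by field_simp; ring
        rw [e]
        exact div_le_div_of_nonneg_right (by linarith) (by positivity)

end Parameters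

/-! ### Improved UCB on a realisation of the outcomes -/

section Deterministic

variable {K : ℕ} {M : ℝ} {T : ℕ} {order : PullOrder K} {x : Fin K → ℕ → ℝ}

/-- The fibres over the arms of B are disjoint, each of size n_s, so they exhaust all |B| n_s
positions. -/
lemma PullOrder.IsValid.mem (h : order.IsValid M T) {s : ℕ} {B : Finset (Fin K)} {l : ℕ}
    (hl : l < B.card * numPulls M T s) : order s B l ∈ B := by
  classical
  set R := Finset.range (B.card * numPulls M T s) with hR
  have h1 : (R.filter fun l => order s B l ∈ B).card = R.card := by
    have hfib := Finset.card_eq_sum_card_fiberwise (f := order s B) (t := B)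
      (s := R.filter fun l => order s B l ∈ B) (fun l hl => (Finset.mem_filter.1 hl).2)
    rw [hfib]
    have : ∀ k ∈ B, ((R.filter fun l => order s B l ∈ B).filter fun l => order s B l = k).card
        = numPulls M T s := by
      intro k hk
      rw [← h s B k hk, Finset.filter_filter]
      congr 1
      ext l
      simp only [Finset.mem_filter]
      constructor
      · rintro ⟨a, _, c⟩; exact ⟨a, c⟩
      · rintro ⟨a, c⟩; exact ⟨a, c ▸ hk, c⟩
    rw [Finset.sum_congr rfl this]
    simp [hR]
  have h2 := Finset.eq_of_subset_of_card_le (Finset.filter_subset _ R) h1.ge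
  have h3 : l ∈ R.filter fun l => order s B l ∈ B := by
    rw [h2]; exact Finset.mem_range.2 hl
  exact (Finset.mem_filter.1 h3).2

/-- The starting time of the epoch `s`. -/
abbrev startTime (M : ℝ) (T : ℕ) (order : PullOrder K) (x : Fin K → ℕ → ℝ) (s : ℕ) : ℕ :=
  (epochState M T order x s).1

/-- The set of active arms in the epoch `s`. -/
abbrev activeArms (M : ℝ) (T : ℕ) (order : PullOrder K) (x : Fin K → ℕ → ℝ) (s : ℕ) :
    Finset (Fin K) :=
  (epochState M T order x s).2

lemma startTime_succ (s : ℕ) : startTime M T order x (s + 1)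
    = startTime M T order x s + (activeArms M T order x s).card * numPulls M T s := rfl

lemma mem_activeArms_succ {s : ℕ} {k : Fin K} : k ∈ activeArms M T order x (s + 1) ↔
    k ∈ activeArms M T order x s ∧ ¬ ∃ j ∈ activeArms M T order x s,
      epochMean M T order x s (startTime M T order x s) (activeArms M T order x s) k + radius M T s
        ≤ epochMean M T order x s (startTime M T order x s) (activeArms M T order x s) j
          - radius M T s := by
  simp [activeArms, startTime, epochState]

lemma startTime_mono : Monotone (startTime M T order x) :=
  monotone_nat_of_le_succ fun s => by rw [startTime_succ]; omega

lemma one_le_startTime (s : ℕ) : 1 ≤ startTime M T order x s :=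
  startTime_mono (Nat.zero_le s)

lemma activeArms_anti : Antitone (activeArms M T order x) :=
  antitone_nat_of_succ_le fun _ _ hk => (mem_activeArms_succ.1 hk).1

lemma activeArms_nonempty (hK : 1 ≤ K) (hM : 0 ≤ M) (hT : 1 ≤ T) {s : ℕ}
    (hs : s ≤ Nat.log 4 T + 1) : (activeArms M T order x s).Nonempty := by
  induction s with
  | zero => exact ⟨⟨0, hK⟩, by simp [activeArms, epochState]⟩
  | succ s ih =>
    obtain ⟨k, hk, hmax⟩ := Finset.exists_max_image (activeArms M T order x s)
      (epochMean M T order x s (startTime M T order x s) (activeArms M T order x s))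
      (ih (by omega))
    refine ⟨k, mem_activeArms_succ.2 ⟨hk, ?_⟩⟩
    rintro ⟨j, hj, h⟩
    have := hmax j hj
    have := radius_pos hM hT (show s ≤ Nat.log 4 T by omega)
    linarith

lemma lt_startTime_log_succ (hK : 1 ≤ K) (hM : 0 ≤ M) (hT : 1 ≤ T) :
    T < startTime M T order x (Nat.log 4 T + 1) := by
  rw [startTime_succ]
  have h1 := one_le_startTime (M := M) (T := T) (order := order) (x := x) (Nat.log 4 T)
  have h2 := (activeArms_nonempty (order := order) (x := x) hK hM hT
    (Nat.le_succ (Nat.log 4 T))).card_pos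
  have h3 := le_numPulls_log hM hT
  have := Nat.le_mul_of_pos_left (numPulls M T (Nat.log 4 T)) h2
  omega

lemma epochOf_spec (hK : 1 ≤ K) (hM : 0 ≤ M) (hT : 1 ≤ T) {t : ℕ} (ht1 : 1 ≤ t) (htT : t ≤ T) :
    epochOf M T order x t ≤ Nat.log 4 T ∧ startTime M T order x (epochOf M T order x t) ≤ t
      ∧ t < startTime M T order x (epochOf M T order x t + 1) := by
  have hmem : Nat.log 4 T ∈ {s : ℕ | t < (epochState M T order x (s + 1)).1} :=
    lt_of_le_of_lt htT (lt_startTime_log_succ hK hM hT)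
  refine ⟨Nat.sInf_le hmem, ?_, Nat.sInf_mem ⟨_, hmem⟩⟩
  rcases h : epochOf M T order x t with _ | s
  · exact ht1
  · have : s ∉ {s : ℕ | t < (epochState M T order x (s + 1)).1} := by
      refine Nat.notMem_of_lt_sInf ?_
      change s < epochOf M T order x t
      omega
    exact not_lt.1 this

lemma decision_mem (hval : order.IsValid M T) (hK : 1 ≤ K) (hM : 0 ≤ M) (hT : 1 ≤ T) {t : ℕ}
    (ht1 : 1 ≤ t) (htT : t ≤ T) :
    decision M T order x t ∈ activeArms M T order x (epochOf M T order x t) := by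
  obtain ⟨_, h2, h3⟩ := epochOf_spec (order := order) (x := x) hK hM hT ht1 htT
  refine hval.mem ?_
  rw [startTime_succ] at h3
  change t - startTime M T order x (epochOf M T order x t) < _
  omega

/-- In an epoch that starts at the time `τ` with the set `B` of active arms, no suboptimal arm is
overestimated, and, unless all arms are optimal, the optimal arm `opt B` is not underestimated by
the confidence radius or more. -/
def EpochOK (μ : Fin K → ℝ) (μs : ℝ) (opt : Finset (Fin K) → Fin K) (M : ℝ) (T : ℕ)
    (order : PullOrder K) (x : Fin K → ℕ → ℝ) (s τ : ℕ) (B : Finset (Fin K)) : Prop :=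
  (∀ j ∈ B, μ j < μs → epochMean M T order x s τ B j < μ j + radius M T s) ∧
    ((∃ j ∈ B, μ j < μs) → μs - radius M T s < epochMean M T order x s τ B (opt B))

/-- All epochs before `s` are as described by `EpochOK`. -/
def OKBefore (μ : Fin K → ℝ) (μs : ℝ) (opt : Finset (Fin K) → Fin K) (M : ℝ) (T : ℕ)
    (order : PullOrder K) (x : Fin K → ℕ → ℝ) (s : ℕ) : Prop :=
  ∀ r < s, EpochOK μ μs opt M T order x r (startTime M T order x r) (activeArms M T order x r)

/-- The epoch `r` is over by the time `T` and the first one not to be as in `EpochOK`. -/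
def FirstBad (μ : Fin K → ℝ) (μs : ℝ) (opt : Finset (Fin K) → Fin K) (M : ℝ) (T : ℕ)
    (order : PullOrder K) (x : Fin K → ℕ → ℝ) (r : ℕ) : Prop :=
  OKBefore μ μs opt M T order x r ∧
    ¬ EpochOK μ μs opt M T order x r (startTime M T order x r) (activeArms M T order x r) ∧
    startTime M T order x (r + 1) ≤ T

variable {μ : Fin K → ℝ} {μs : ℝ} {opt : Finset (Fin K) → Fin K}

/-- The optimal arm with the largest estimate survives: a suboptimal rival has est - radius < μ_j <
μs < est (opt B) + radius. The arm `opt B` itself may be discarded, which is why it is chosen anew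
for each B. An arm with gap at least 2θ_s is discarded by `opt B`, since 4 · radius ≤ 2θ_s. -/
lemma OKBefore.spec (hM : 0 ≤ M) (hT : 1 ≤ T) (hμ : ∀ k, μ k ≤ μs) (hμ1 : ∀ k, μs - μ k ≤ 1)
    (hex : ∃ k, μ k = μs)
    (hopt : ∀ B : Finset (Fin K), (∃ k ∈ B, μ k = μs) → opt B ∈ B ∧ μ (opt B) = μs) {s : ℕ}
    (hs : s ≤ Nat.log 4 T + 1) (h : OKBefore μ μs opt M T order x s) :
    (∃ k ∈ activeArms M T order x s, μ k = μs) ∧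
      ∀ j ∈ activeArms M T order x s, μs - μ j < 4 * (1 / 2 : ℝ) ^ s := by
  classical
  induction s with
  | zero =>
    obtain ⟨k, hk⟩ := hex
    refine ⟨⟨k, by simp [activeArms, epochState], hk⟩, fun j _ => ?_⟩
    have := hμ1 j
    norm_num
    linarith
  | succ s ih =>
    obtain ⟨⟨k₀, hk₀, hk₀'⟩, _⟩ := ih (by omega) fun r hr => h r (by omega)
    have hsS : s ≤ Nat.log 4 T := by omega
    have hr0 := radius_pos hM hT hsS
    have hr1 := radius_le hM hT hsS
    obtain ⟨hOK1, hOK2⟩ := h s (Nat.lt_succ_self s)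
    set B := activeArms M T order x s with hB
    set est := epochMean M T order x s (startTime M T order x s) B with hest
    obtain ⟨hoB, hoμ⟩ := hopt B ⟨k₀, hk₀, hk₀'⟩
    constructor
    · obtain ⟨k, hk, hmax⟩ := Finset.exists_max_image (B.filter fun k => μ k = μs) est
        ⟨k₀, by simp [hk₀, hk₀']⟩
      obtain ⟨hkB, hkμ⟩ := Finset.mem_filter.1 hk
      refine ⟨k, mem_activeArms_succ.2 ⟨hkB, ?_⟩, hkμ⟩
      rintro ⟨j, hj, hle⟩
      rcases (hμ j).lt_or_eq with hlt | heq
      · have h1 := hOK1 j hj hlt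
        have h2 := hOK2 ⟨j, hj, hlt⟩
        have h3 := hmax (opt B) (by simp [hoB, hoμ])
        linarith
      · have h3 := hmax j (Finset.mem_filter.2 ⟨hj, heq⟩)
        linarith
    · intro j hj
      obtain ⟨hjB, hjn⟩ := mem_activeArms_succ.1 hj
      by_contra! hge
      have hp : (1 / 2 : ℝ) ^ (s + 1) = (1 / 2 : ℝ) ^ s / 2 := by rw [pow_succ]; ring
      have hpos : (0 : ℝ) < (1 / 2 : ℝ) ^ s := by positivity
      have hlt : μ j < μs := by rw [hp] at hge; linarith
      have h1 := hOK1 j hjB hlt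
      have h2 := hOK2 ⟨j, hjB, hlt⟩
      refine hjn ⟨opt B, hoB, ?_⟩
      rw [hp] at hge
      linarith

open Classical in
/-- Up to `lam`, the gap of the arm pulled at the time `t` is accounted for either by an arm with
gap above `lam` in an epoch before which nothing went wrong, or by the first bad epoch. -/
lemma gap_decision_le (hval : order.IsValid M T) (hK : 1 ≤ K) (hM : 0 ≤ M) (hT : 1 ≤ T)
    (hμ : ∀ k, μ k ≤ μs) (hμ1 : ∀ k, μs - μ k ≤ 1) (hex : ∃ k, μ k = μs)
    (hopt : ∀ B : Finset (Fin K), (∃ k ∈ B, μ k = μs) → opt B ∈ B ∧ μ (opt B) = μs)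
    {lam : ℝ} (hlam : 0 ≤ lam) {t : ℕ} (ht1 : 1 ≤ t) (htT : t ≤ T) :
    μs - μ (decision M T order x t) ≤ lam
      + ∑ k ∈ Finset.univ.filter (fun k => lam < μs - μ k), (μs - μ k) *
        (if decision M T order x t = k ∧ OKBefore μ μs opt M T order x (epochOf M T order x t)
          then 1 else 0)
      + ∑ r ∈ (Finset.range (Nat.log 4 T + 1)).filter (fun r => lam < 4 * (1 / 2 : ℝ) ^ r),
        4 * (1 / 2 : ℝ) ^ r * (if FirstBad μ μs opt M T order x r then 1 else 0) := by
  obtain ⟨hs, hle, hlt⟩ := epochOf_spec (order := order) (x := x) hK hM hT ht1 htT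
  have hmem := decision_mem (x := x) hval hK hM hT ht1 htT
  set s := epochOf M T order x t with hsdef
  set k := decision M T order x t with hk
  have hnn1 : ∀ k' ∈ Finset.univ.filter (fun k => lam < μs - μ k), 0 ≤ (μs - μ k') *
      (if k = k' ∧ OKBefore μ μs opt M T order x s then (1 : ℝ) else 0) := fun k' _ =>
    mul_nonneg (by linarith [hμ k']) (by split_ifs <;> norm_num)
  have hnn2 : ∀ r ∈ (Finset.range (Nat.log 4 T + 1)).filter (fun r => lam < 4 * (1 / 2 : ℝ) ^ r),
      0 ≤ 4 * (1 / 2 : ℝ) ^ r * (if FirstBad μ μs opt M T order x r then (1 : ℝ) else 0) :=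
    fun r _ => mul_nonneg (by positivity) (by split_ifs <;> norm_num)
  have hs1 := Finset.sum_nonneg hnn1
  have hs2 := Finset.sum_nonneg hnn2
  by_cases hgap : μs - μ k ≤ lam
  · linarith
  push Not at hgap
  by_cases hok : OKBefore μ μs opt M T order x s
  · have h := Finset.single_le_sum hnn1 (Finset.mem_filter.2 ⟨Finset.mem_univ k, hgap⟩)
    simp only [hok, and_true, if_true, mul_one] at h hs1 ⊢
    linarith
  -- The first bad epoch r precedes s. The active sets shrink, so the arm pulled now was active in
  -- epoch r, where all gaps were still below 4θ_r.
  · have hbad : ∃ r, r < s ∧ ¬ EpochOK μ μs opt M T order x r (startTime M T order x r)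
        (activeArms M T order x r) := by
      by_contra! h
      exact hok h
    obtain ⟨hr1, hr2⟩ := Nat.find_spec hbad
    set r := Nat.find hbad with hr
    have hbefore : OKBefore μ μs opt M T order x r := fun r' hr' => by
      by_contra h
      exact Nat.find_min hbad hr' ⟨hr'.trans hr1, h⟩
    have hFB : FirstBad μ μs opt M T order x r :=
      ⟨hbefore, hr2, ((startTime_mono (Nat.succ_le_of_lt hr1)).trans hle).trans htT⟩
    have hg := (hbefore.spec hM hT hμ hμ1 hex hopt (by omega)).2 k (activeArms_anti hr1.le hmem)
    have h := Finset.single_le_sum hnn2 (Finset.mem_filter.2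
      ⟨Finset.mem_range.2 (show r < Nat.log 4 T + 1 by omega), hgap.trans hg⟩)
    simp only [hFB, if_true, mul_one] at h hs2 ⊢
    linarith

open Classical in
-- A counted pull lies in an epoch s reached without a bad epoch, so the gap is below 4θ_s there;
-- each such epoch contributes at most n_s pulls.
lemma card_pulls_le (hval : order.IsValid M T) (hK : 1 ≤ K) (hM : 0 ≤ M) (hT : 1 ≤ T)
    (hμ : ∀ k, μ k ≤ μs) (hμ1 : ∀ k, μs - μ k ≤ 1) (hex : ∃ k, μ k = μs)
    (hopt : ∀ B : Finset (Fin K), (∃ k ∈ B, μ k = μs) → opt B ∈ B ∧ μ (opt B) = μs) (k : Fin K) :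
    ((Finset.Icc 1 T).filter fun t => decision M T order x t = k ∧
        OKBefore μ μs opt M T order x (epochOf M T order x t)).card
      ≤ ∑ s ∈ (Finset.range (Nat.log 4 T + 1)).filter (fun s => μs - μ k < 4 * (1 / 2 : ℝ) ^ s),
        numPulls M T s := by
  set D : ℕ → Finset ℕ := fun s => if k ∈ activeArms M T order x s then
    ((Finset.range ((activeArms M T order x s).card * numPulls M T s)).filter
      fun l => order s (activeArms M T order x s) l = k).image (startTime M T order x s + ·) else ∅
    with hD
  have hcard : ∀ s, (D s).card ≤ numPulls M T s := by
    intro s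
    by_cases h : k ∈ activeArms M T order x s
    · simp only [hD, h, if_true]
      exact Finset.card_image_le.trans (hval s _ k h).le
    · simp [hD, h]
  refine (Finset.card_le_card ?_).trans ((Finset.card_biUnion_le (t := D)).trans
    (Finset.sum_le_sum fun s _ => hcard s))
  intro t ht
  obtain ⟨htI, hdec, hok⟩ := Finset.mem_filter.1 ht
  obtain ⟨ht1, htT⟩ := Finset.mem_Icc.1 htI
  obtain ⟨hs, hle, hlt⟩ := epochOf_spec (order := order) (x := x) hK hM hT ht1 htT
  have hmem := decision_mem (x := x) hval hK hM hT ht1 htT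
  have hmem' := hmem
  rw [hdec] at hmem'
  have hg := (hok.spec hM hT hμ hμ1 hex hopt (by omega)).2 k hmem'
  refine Finset.mem_biUnion.2 ⟨epochOf M T order x t, ?_, ?_⟩
  · exact Finset.mem_filter.2 ⟨Finset.mem_range.2 (by omega), hg⟩
  · simp only [hD, hmem', if_true]
    refine Finset.mem_image.2 ⟨t - startTime M T order x (epochOf M T order x t), ?_, by omega⟩
    refine Finset.mem_filter.2 ⟨Finset.mem_range.2 ?_, hdec⟩
    rw [startTime_succ] at hlt
    omega

open Classical in
/-- The pathwise regret bound. -/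
lemma sum_gap_decision_le (hval : order.IsValid M T) (hK : 1 ≤ K) (hM : 0 ≤ M) (hT : 1 ≤ T)
    (hμ : ∀ k, μ k ≤ μs) (hμ1 : ∀ k, μs - μ k ≤ 1) (hex : ∃ k, μ k = μs)
    (hopt : ∀ B : Finset (Fin K), (∃ k ∈ B, μ k = μs) → opt B ∈ B ∧ μ (opt B) = μs)
    {lam : ℝ} (hlam : 0 ≤ lam) (hlog : ∀ k, lam < μs - μ k → -1 ≤ Real.log (T * (μs - μ k) ^ 2)) :
    ∑ t ∈ Finset.Icc 1 T, (μs - μ (decision M T order x t)) ≤ lam * T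
      + ∑ k ∈ Finset.univ.filter (fun k => lam < μs - μ k), 16 * (1 + M) ^ 2 *
        ((96 + 32 * Real.log (T * (μs - μ k) ^ 2)) / (μs - μ k))
      + ∑ r ∈ (Finset.range (Nat.log 4 T + 1)).filter (fun r => lam < 4 * (1 / 2 : ℝ) ^ r),
        T * (4 * (1 / 2 : ℝ) ^ r) * (if FirstBad μ μs opt M T order x r then 1 else 0) := by
  have h := Finset.sum_le_sum fun t (ht : t ∈ Finset.Icc 1 T) =>
    gap_decision_le (x := x) hval hK hM hT hμ hμ1 hex hopt hlam (Finset.mem_Icc.1 ht).1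
      (Finset.mem_Icc.1 ht).2
  refine h.trans ?_
  rw [Finset.sum_add_distrib, Finset.sum_add_distrib, Finset.sum_comm]
  refine add_le_add (add_le_add ?_ ?_) ?_
  · simp [mul_comm]
  · refine Finset.sum_le_sum fun k hk => ?_
    have hgk := (Finset.mem_filter.1 hk).2
    have hd : 0 < μs - μ k := hlam.trans_lt hgk
    have hc := card_pulls_le (x := x) hval hK hM hT hμ hμ1 hex hopt k
    have hn := sum_numPulls_le hM hT hd (hlog k hgk)
    rw [← Finset.mul_sum, Finset.sum_boole]
    have hc' := (Nat.cast_le (α := ℝ)).2 hc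
    rw [Nat.cast_sum] at hc'
    calc _ ≤ (μs - μ k) * (16 * (1 + M) ^ 2 *
          ((96 + 32 * Real.log (T * (μs - μ k) ^ 2)) / (μs - μ k) ^ 2)) := by
          gcongr
          exact hc'.trans hn
      _ = _ := by field_simp
  · rw [Finset.sum_const, nsmul_eq_mul, Finset.mul_sum]
    refine Finset.sum_le_sum fun r _ => le_of_eq ?_
    simp only [Nat.card_Icc, Nat.add_sub_cancel]
    ring

end Deterministic

/-! ### Improved UCB on random outcomes -/

section Random

variable {Ω : Type*} {K : ℕ} {X : Fin K → ℕ → Ω → unitInterval}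

lemma jointHistory_mono : Monotone (jointHistory X) := fun _ _ hij =>
  iSup_mono fun _ => biSup_mono fun _ hl => ⟨hl.1, hl.2.trans hij⟩

lemma jointHistory_le [MeasurableSpace Ω] (hX : ∀ k t, Measurable (X k t)) (i : ℕ) :
    jointHistory X i ≤ ‹MeasurableSpace Ω› :=
  iSup_le fun k => iSup₂_le fun j _ => (hX k j).comap_le

lemma jointHistory_zero : jointHistory X 0 = ⊥ := by
  refine le_bot_iff.1 (iSup_le fun k => iSup₂_le fun j hj => ?_)
  have := hj.1.trans hj.2
  omega

lemma measurable_jointHistory {k : Fin K} {i j : ℕ} (h1 : 1 ≤ j) (hij : j ≤ i) :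
    Measurable[jointHistory X i] (X k j) := by
  rw [measurable_iff_comap_le]
  exact le_trans (le_iSup₂_of_le (f := fun j (_ : j ∈ Set.Icc 1 i) =>
    MeasurableSpace.comap (X k j) inferInstance) j ⟨h1, hij⟩ le_rfl)
    (le_iSup (fun k => ⨆ j ∈ Set.Icc 1 i, MeasurableSpace.comap (X k j) inferInstance) k)

lemma measurable_coe_jointHistory {k : Fin K} {i j : ℕ} (h1 : 1 ≤ j) (hij : j ≤ i) :
    Measurable[jointHistory X i] (fun ω => (X k j ω : ℝ)) :=
  measurable_subtype_coe.comp (measurable_jointHistory h1 hij)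

lemma abs_condExp_sub_armMean_le [MeasurableSpace Ω] {P : Measure Ω} [IsProbabilityMeasure P]
    {T : ℕ} (hX : ∀ k t, Measurable (X k t)) (hstat : StationaryMeans P T X) {𝒞 : TestClass}
    (hid : (fun x : unitInterval => (x : ℝ)) ∈ 𝒞.unitBall) {α : ℝ} (hmix : FastMixing P 𝒞 T X α)
    (k : Fin K) {i j : ℕ} (hij : i < j) (hjT : j ≤ T) :
    ∀ᵐ ω ∂P, |(P[fun ω => (X k j ω : ℝ) - armMean P X k | jointHistory X i]) ω|
      ≤ ((j - i : ℕ) : ℝ) ^ (-α) := by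
  have hint : Integrable (fun ω => (X k j ω : ℝ)) P :=
    Integrable.of_bound (measurable_subtype_coe.comp (hX k j)).aestronglyMeasurable 1
      (Filter.Eventually.of_forall fun ω => by
        rw [Real.norm_eq_abs, abs_of_nonneg (X k j ω).2.1]; exact (X k j ω).2.2)
  have hmean : ∫ ω, (X k j ω : ℝ) ∂P = armMean P X k :=
    hstat k j (Finset.mem_Icc.2 ⟨by omega, hjT⟩)
  have hle := jointHistory_le hX i
  have hsub := condExp_sub hint (integrable_const (armMean P X k)) (jointHistory X i)
  rw [condExp_const hle] at hsub
  -- The mixing coefficients only concern i ≥ 1. At i = 0 the history is trivial and stationarity of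
  -- the mean gives exactly zero.
  rcases Nat.eq_zero_or_pos i with rfl | hi
  · rw [jointHistory_zero, condExp_bot]
    refine Filter.Eventually.of_forall fun ω => ?_
    rw [integral_sub hint (integrable_const _), hmean]
    simp only [integral_const, probReal_univ, one_smul, sub_self, abs_zero]
    positivity
  · obtain ⟨t, ht⟩ : ∃ t, j = i + (t + 1) := ⟨j - i - 1, by omega⟩
    subst ht
    have h := hmix k (t + 1) (by omega)
    have h' : eLpNorm (fun ω => (P[fun ω' => (X k (i + (t + 1)) ω' : ℝ) | jointHistory X i]) ω
        - ∫ ω', (X k (i + (t + 1)) ω' : ℝ) ∂P) ∞ P ≤ ENNReal.ofReal (((t + 1 : ℕ) : ℝ) ^ (-α)) :=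
      le_trans (le_iSup₂_of_le (f := fun φ (_ : φ ∈ 𝒞.unitBall) =>
        ⨆ i ∈ {i : ℕ | 1 ≤ i ∧ i + (t + 1) ≤ T},
          eLpNorm (fun ω => (P[fun ω' => φ (X k (i + (t + 1)) ω') | jointHistory X i]) ω
            - ∫ ω', φ (X k (i + (t + 1)) ω') ∂P) ∞ P) _ hid
        (le_iSup₂_of_le (f := fun i (_ : i ∈ {i : ℕ | 1 ≤ i ∧ i + (t + 1) ≤ T}) =>
          eLpNorm (fun ω => (P[fun ω' => (X k (i + (t + 1)) ω' : ℝ) | jointHistory X i]) ω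
            - ∫ ω', (X k (i + (t + 1)) ω' : ℝ) ∂P) ∞ P) i ⟨hi, hjT⟩ le_rfl)) h
    rw [eLpNorm_exponent_top, hmean] at h'
    filter_upwards [hsub, ae_le_eLpNormEssSup (μ := P) (f := fun ω =>
      (P[fun ω' => (X k (i + (t + 1)) ω' : ℝ) | jointHistory X i]) ω - armMean P X k)] with ω h1 h2
    have h3 := h2.trans h'
    rw [Real.enorm_eq_ofReal_abs, ENNReal.ofReal_le_ofReal_iff (by positivity)] at h3
    have e2 : i + (t + 1) - i = t + 1 := by omega
    change (P[fun ω => (X k (i + (t + 1)) ω : ℝ) - armMean P X k | jointHistory X i]) ω = _ at h1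
    rw [h1, e2]
    exact h3

variable {M : ℝ} {T : ℕ} {order : PullOrder K}

/-- The deviation of the average of an arm over an epoch exceeds the confidence radius with small
probability, conditionally on the history before that epoch. -/
lemma measureReal_epochMean_le [MeasurableSpace Ω] {P : Measure Ω} [IsProbabilityMeasure P]
    (hX : ∀ k t, Measurable (X k t)) (hstat : StationaryMeans P T X) {𝒞 : TestClass}
    (hid : (fun x : unitInterval => (x : ℝ)) ∈ 𝒞.unitBall) {α : ℝ} (hα : 1 / 2 < α)
    (hmix : FastMixing P 𝒞 T X α) (hval : order.IsValid M T) (hT : 1 ≤ T)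
    (hM : 80 * mixSeries α ≤ M) {s τ : ℕ} (hs : s ≤ Nat.log 4 T) (hτ : 1 ≤ τ)
    {B : Finset (Fin K)} (hτT : τ + B.card * numPulls M T s ≤ T) {k : Fin K} (hk : k ∈ B)
    {A : Set Ω} (hA : MeasurableSet[jointHistory X (τ - 1)] A) {c : ℝ} (hc : |c| = 1) :
    P.real (A ∩ {ω | radius M T s
        ≤ c * (epochMean M T order (fun k j => (X k j ω : ℝ)) s τ B k - armMean P X k)})
      ≤ Real.exp (-logTerm T s) * P.real A := by
  have hM0 : 0 ≤ M := by linarith [one_le_mixSeries hα]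
  set R := (Finset.range (B.card * numPulls M T s)).filter (fun l => order s B l = k) with hR
  have hRc : R.card = numPulls M T s := hval s B k hk
  set J := R.map (addLeftEmbedding τ) with hJ
  have hJc : J.card = numPulls M T s := by rw [hJ, Finset.card_map, hRc]
  have hJmem : ∀ j ∈ J, τ ≤ j ∧ j ≤ T := by
    intro j hj
    obtain ⟨l, hl, rfl⟩ := Finset.mem_map.1 hj
    have := Finset.mem_range.1 (Finset.mem_filter.1 hl).1
    simp only [addLeftEmbedding_apply]
    omega
  have hμ01 : 0 ≤ armMean P X k ∧ armMean P X k ≤ 1 := by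
    constructor
    · exact integral_nonneg fun ω => (X k 1 ω).2.1
    · calc armMean P X k ≤ ∫ _ω, (1 : ℝ) ∂P :=
          integral_mono_of_nonneg (Filter.Eventually.of_forall fun ω => (X k 1 ω).2.1)
            (integrable_const _) (Filter.Eventually.of_forall fun ω => (X k 1 ω).2.2)
        _ = 1 := by simp
  have hn : 0 < numPulls M T s := numPulls_pos hM0 hT hs
  have hn' : (0 : ℝ) < numPulls M T s := by exact_mod_cast hn
  have h := measureReal_sum_ge_le (P := P) (F := jointHistory X) jointHistory_mono
    (jointHistory_le hX) (τ := τ - 1) (J := J) (fun j hj => by have := hJmem j hj; omega)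
    (Y := fun j ω => c * ((X k j ω : ℝ) - armMean P X k))
    (fun j hj => (((measurable_coe_jointHistory (hτ.trans (hJmem j hj).1) le_rfl).sub
      measurable_const).const_mul c).stronglyMeasurable)
    (fun j ω => by
      rw [abs_mul, hc, one_mul, abs_le]
      have h1 := (X k j ω).2.1
      have h2 := (X k j ω).2.2
      constructor <;> linarith)
    hα (fun i j _ hj hij => by
      have h1 := abs_condExp_sub_armMean_le hX hstat hid hmix k hij (hJmem j hj).2
      have h2 := condExp_smul (μ := P) c (fun ω => (X k j ω : ℝ) - armMean P X k)
        (jointHistory X i)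
      filter_upwards [h1, h2] with ω h1 h2
      change |(P[c • (fun ω => (X k j ω : ℝ) - armMean P X k) | jointHistory X i]) ω| ≤ _
      rw [h2, Pi.smul_apply, smul_eq_mul, abs_mul, hc, one_mul]
      exact h1)
    hA (by omega) hM (one_le_logTerm hT hs)
  refine le_trans (le_of_eq ?_) h
  congr 2
  ext ω
  simp only [Set.mem_ofPred_eq]
  rw [hJc, ← numPulls_mul_radius hM0 hT hs, ← Finset.mul_sum, hJ, Finset.sum_map,
    Finset.sum_sub_distrib, Finset.sum_const, hRc, nsmul_eq_mul]
  have e : c * (∑ l ∈ R, (X k (addLeftEmbedding τ l) ω : ℝ) - numPulls M T s * armMean P X k)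
      = numPulls M T s * (c * (epochMean M T order (fun k j => (X k j ω : ℝ)) s τ B k
        - armMean P X k)) := by
    rw [epochMean]
    simp only [addLeftEmbedding_apply]
    field_simp
    rfl
  rw [e, mul_le_mul_iff_right₀ hn']

lemma measurable_epochMean {s τ : ℕ} (hτ : 1 ≤ τ) (B : Finset (Fin K)) (k : Fin K) :
    Measurable[jointHistory X (τ + B.card * numPulls M T s - 1)]
      (fun ω => epochMean M T order (fun k j => (X k j ω : ℝ)) s τ B k) := by
  unfold epochMean
  refine Measurable.div_const (Finset.measurable_sum _ fun l hl => ?_) _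
  have := Finset.mem_range.1 (Finset.mem_filter.1 hl).1
  exact measurable_coe_jointHistory (by omega) (by omega)

variable (μ : Fin K → ℝ) (μs : ℝ) (opt : Finset (Fin K) → Fin K)

lemma measurableSet_epochOK {s τ : ℕ} (hτ : 1 ≤ τ) (B : Finset (Fin K)) :
    MeasurableSet[jointHistory X (τ + B.card * numPulls M T s - 1)]
      {ω | EpochOK μ μs opt M T order (fun k j => (X k j ω : ℝ)) s τ B} := by
  let _ := jointHistory X (τ + B.card * numPulls M T s - 1)
  have hm := measurable_epochMean (X := X) (M := M) (T := T) (order := order) (s := s) hτ B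
  unfold EpochOK
  refine MeasurableSet.inter ?_ ?_
  · change MeasurableSet {ω | ∀ j, ∀ _ : j ∈ B, ∀ _ : μ j < μs,
      epochMean M T order (fun k j => (X k j ω : ℝ)) s τ B j < μ j + radius M T s}
    simp only [Set.ofPred_forall]
    exact MeasurableSet.iInter fun j => MeasurableSet.iInter fun _ => MeasurableSet.iInter fun _ =>
      measurableSet_lt (hm j) measurable_const
  · change MeasurableSet {ω | ∀ _ : (∃ j ∈ B, μ j < μs), μs - radius M T s
      < epochMean M T order (fun k j => (X k j ω : ℝ)) s τ B (opt B)}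
    rw [Set.ofPred_forall]
    exact MeasurableSet.iInter fun _ => measurableSet_lt measurable_const (hm _)

/-- The event that the epoch `s` starts at the time `τ` with the set `B` of active arms, all
previous epochs being as in `EpochOK`. -/
def stateEvent (M : ℝ) (T : ℕ) (order : PullOrder K) (X : Fin K → ℕ → Ω → unitInterval)
    (s : ℕ) (p : ℕ × Finset (Fin K)) : Set Ω :=
  {ω | epochState M T order (fun k j => (X k j ω : ℝ)) s = p ∧
    OKBefore μ μs opt M T order (fun k j => (X k j ω : ℝ)) s}

/-- A stopping-time property: once τ and B are fixed, the event depends only on outcomes observed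
before τ, because the pulling order is a function of s and B. -/
lemma measurableSet_stateEvent (s : ℕ) (p : ℕ × Finset (Fin K)) :
    MeasurableSet[jointHistory X (p.1 - 1)] (stateEvent μ μs opt M T order X s p) := by
  classical
  induction s generalizing p with
  | zero =>
    have : stateEvent μ μs opt M T order X 0 p
        = {_ω | ((1, Finset.univ) : ℕ × Finset (Fin K)) = p} := by
      ext ω
      simp [stateEvent, OKBefore, epochState]
    rw [this]
    exact MeasurableSet.const _
  | succ s ih =>
    -- Decomposition over the countably many previous states q. For each q the estimates are
    -- averages over deterministic times before the new starting time.
    have e : stateEvent μ μs opt M T order X (s + 1) p = ⋃ q : ℕ × Finset (Fin K),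
        {ω | (1 ≤ q.1 ∧ p.1 = q.1 + q.2.card * numPulls M T s) ∧
          (ω ∈ stateEvent μ μs opt M T order X s q ∧
          EpochOK μ μs opt M T order (fun k j => (X k j ω : ℝ)) s q.1 q.2 ∧
          ∀ k, (k ∈ q.2 ∧ ¬ ∃ j ∈ q.2,
            epochMean M T order (fun k j => (X k j ω : ℝ)) s q.1 q.2 k + radius M T s
              ≤ epochMean M T order (fun k j => (X k j ω : ℝ)) s q.1 q.2 j - radius M T s)
            ↔ k ∈ p.2)} := by
      ext ω
      simp only [Set.mem_iUnion, Set.mem_ofPred_eq]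
      set x : Fin K → ℕ → ℝ := fun k j => (X k j ω : ℝ) with hx
      constructor
      · rintro ⟨h1, h2⟩
        refine ⟨epochState M T order x s, ⟨one_le_startTime s, ?_⟩,
          ⟨rfl, fun r hr => h2 r (by omega)⟩, h2 s (Nat.lt_succ_self s), fun k => ?_⟩
        · rw [← h1]; rfl
        · rw [← h1]; exact mem_activeArms_succ.symm
      · rintro ⟨q, ⟨_, hp⟩, ⟨hq, hok⟩, hok', hk⟩
        refine ⟨Prod.ext ?_ ?_, fun r hr => ?_⟩
        · rw [hp, ← hq]; rfl
        · ext k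
          rw [← hk k, ← hq]
          exact mem_activeArms_succ
        · rcases Nat.lt_succ_iff_lt_or_eq.1 hr with hr | rfl
          · exact hok r hr
          · rw [startTime, activeArms, hq]; exact hok'
    rw [e]
    refine MeasurableSet.iUnion fun q => ?_
    by_cases hq : 1 ≤ q.1 ∧ p.1 = q.1 + q.2.card * numPulls M T s
    · simp only [hq, true_and]
      rw [hq.2]
      have hm := measurable_epochMean (X := X) (M := M) (T := T) (order := order) (s := s) hq.1 q.2
      refine MeasurableSet.inter (jointHistory_mono (by omega) _ (ih q)) (MeasurableSet.inter
        (measurableSet_epochOK μ μs opt hq.1 q.2) ?_)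
      let _ := jointHistory X (q.1 + q.2.card * numPulls M T s - 1)
      change MeasurableSet {ω | ∀ k, _}
      rw [Set.ofPred_forall]
      refine MeasurableSet.iInter fun k => ?_
      refine MeasurableSet.iff (MeasurableSet.inter (MeasurableSet.const _)
        (MeasurableSet.compl ?_)) (MeasurableSet.const _)
      change MeasurableSet {ω | ∃ j, j ∈ q.2 ∧ _}
      rw [Set.ofPred_exists]
      exact MeasurableSet.iUnion fun j => MeasurableSet.inter (MeasurableSet.const _)
        (measurableSet_le ((hm k).add_const _) ((hm j).sub_const _))
    · simp only [hq, false_and]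
      exact MeasurableSet.const _

end Random

/-! ### The regret bound -/

section Regret

variable {Ω : Type*} {K : ℕ} {X : Fin K → ℕ → Ω → unitInterval} {M : ℝ} {T : ℕ}
  {order : PullOrder K} [MeasurableSpace Ω] {P : Measure Ω}

lemma armMean_le_bestMean (k : Fin K) : armMean P X k ≤ bestMean P X :=
  le_ciSup (Set.finite_range _).bddAbove k

lemma exists_armMean_eq_bestMean (hK : 1 ≤ K) : ∃ k, armMean P X k = bestMean P X :=
  haveI : Nonempty (Fin K) := ⟨⟨0, hK⟩⟩
  exists_eq_ciSup_of_finite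

variable [IsProbabilityMeasure P]

lemma armMean_mem_Icc (k : Fin K) : armMean P X k ∈ Set.Icc (0 : ℝ) 1 := by
  constructor
  · exact integral_nonneg fun ω => (X k 1 ω).2.1
  · calc armMean P X k ≤ ∫ _ω, (1 : ℝ) ∂P :=
        integral_mono_of_nonneg (Filter.Eventually.of_forall fun ω => (X k 1 ω).2.1)
          (integrable_const _) (Filter.Eventually.of_forall fun ω => (X k 1 ω).2.2)
      _ = 1 := by simp

lemma bestMean_sub_armMean_le_one (hK : 1 ≤ K) (k : Fin K) :
    bestMean P X - armMean P X k ≤ 1 := by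
  obtain ⟨j, hj⟩ := exists_armMean_eq_bestMean (P := P) (X := X) hK
  rw [← hj]
  linarith [(armMean_mem_Icc (P := P) (X := X) j).2, (armMean_mem_Icc (P := P) (X := X) k).1]

lemma measurableSet_stateEvent' (hX : ∀ k t, Measurable (X k t)) (μ : Fin K → ℝ) (μs : ℝ)
    (opt : Finset (Fin K) → Fin K) (s : ℕ) (p : ℕ × Finset (Fin K)) :
    MeasurableSet (stateEvent μ μs opt M T order X s p) :=
  jointHistory_le hX _ _ (measurableSet_stateEvent μ μs opt s p)

variable {opt : Finset (Fin K) → Fin K}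

open Classical in
-- On a nonempty state event, `OKBefore.spec` makes every active suboptimal arm have gap below 4θ_r
-- and `opt B` optimal. Each suboptimal arm then accounts for two tail events.
lemma measureReal_stateEvent_not_epochOK_le (hX : ∀ k t, Measurable (X k t))
    (hstat : StationaryMeans P T X) {𝒞 : TestClass}
    (hid : (fun x : unitInterval => (x : ℝ)) ∈ 𝒞.unitBall) {α : ℝ} (hα : 1 / 2 < α)
    (hmix : FastMixing P 𝒞 T X α) (hval : order.IsValid M T) (hK : 1 ≤ K) (hT : 1 ≤ T)
    (hM : 80 * mixSeries α ≤ M)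
    (hopt : ∀ B : Finset (Fin K), (∃ k ∈ B, armMean P X k = bestMean P X) →
      opt B ∈ B ∧ armMean P X (opt B) = bestMean P X)
    {r : ℕ} (hr : r ≤ Nat.log 4 T) {p : ℕ × Finset (Fin K)} (hp1 : 1 ≤ p.1)
    (hpT : p.1 + p.2.card * numPulls M T r ≤ T) :
    P.real (stateEvent (armMean P X) (bestMean P X) opt M T order X r p ∩
        {ω | ¬ EpochOK (armMean P X) (bestMean P X) opt M T order (fun k j => (X k j ω : ℝ))
          r p.1 p.2})
      ≤ ((gapSet P X 0).filter fun j => gap P X j < 4 * (1 / 2 : ℝ) ^ r).card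
        * (2 * Real.exp (-logTerm T r))
        * P.real (stateEvent (armMean P X) (bestMean P X) opt M T order X r p) := by
  have hM0 : 0 ≤ M := by linarith [one_le_mixSeries hα]
  set A := stateEvent (armMean P X) (bestMean P X) opt M T order X r p with hA
  have hAm : MeasurableSet[jointHistory X (p.1 - 1)] A := measurableSet_stateEvent _ _ _ _ _
  rcases A.eq_empty_or_nonempty with hemp | ⟨ω₀, hω₀, hok₀⟩
  · rw [hemp]; simp
  obtain ⟨⟨k₀, hk₀, hk₀'⟩, hgaps⟩ := hok₀.spec hM0 hT armMean_le_bestMean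
    (bestMean_sub_armMean_le_one hK) (exists_armMean_eq_bestMean hK) hopt (by omega)
  rw [activeArms, hω₀] at hk₀ hgaps
  obtain ⟨hoB, hoμ⟩ := hopt p.2 ⟨k₀, hk₀, hk₀'⟩
  set D := (gapSet P X 0).filter fun j => gap P X j < 4 * (1 / 2 : ℝ) ^ r with hD
  set D' := p.2.filter fun j => armMean P X j < bestMean P X with hD'
  have hDD : D' ⊆ D := by
    intro j hj
    obtain ⟨h1, h2⟩ := Finset.mem_filter.1 hj
    refine Finset.mem_filter.2 ⟨Finset.mem_filter.2 ⟨Finset.mem_univ j, ?_⟩, hgaps j h1⟩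
    unfold gap
    linarith
  set E : Fin K → ℝ → Set Ω := fun k c => A ∩ {ω | radius M T r
        ≤ c * (epochMean M T order (fun k j => (X k j ω : ℝ)) r p.1 p.2 k - armMean P X k)} with hE
  have htail : ∀ k ∈ p.2, ∀ c : ℝ, |c| = 1 → P.real (E k c)
      ≤ Real.exp (-logTerm T r) * P.real A := fun k hk c hc =>
    measureReal_epochMean_le hX hstat hid hα hmix hval hT hM hr hp1 hpT hk hAm hc
  -- The underestimation of `opt B` is charged to every suboptimal active arm. If there is none, the
  -- union is empty, as it should be since nothing can then fail.
  have hsub : A ∩ {ω | ¬ EpochOK (armMean P X) (bestMean P X) opt M T order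
      (fun k j => (X k j ω : ℝ)) r p.1 p.2} ⊆ ⋃ j ∈ D', (E j 1 ∪ E (opt p.2) (-1)) := by
    rintro ω ⟨hω, hnot⟩
    simp only [Set.mem_iUnion]
    by_contra! hno
    refine hnot ⟨fun j hj hlt => ?_, fun ⟨j, hj, hlt⟩ => ?_⟩
    · by_contra! hge
      refine hno j (Finset.mem_filter.2 ⟨hj, hlt⟩) (Or.inl ⟨hω, ?_⟩)
      change radius M T r ≤ _
      linarith
    · by_contra! hge
      refine hno j (Finset.mem_filter.2 ⟨hj, hlt⟩) (Or.inr ⟨hω, ?_⟩)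
      change radius M T r ≤ _
      rw [hoμ]
      linarith
  have hA0 : 0 ≤ P.real A := measureReal_nonneg
  calc _ ≤ P.real (⋃ j ∈ D', (E j 1 ∪ E (opt p.2) (-1))) := measureReal_mono hsub (measure_ne_top _ _)
    _ ≤ ∑ j ∈ D', P.real (E j 1 ∪ E (opt p.2) (-1)) := measureReal_biUnion_finset_le _ _
    _ ≤ ∑ _j ∈ D', 2 * Real.exp (-logTerm T r) * P.real A := by
        refine Finset.sum_le_sum fun j hj => (measureReal_union_le _ _).trans ?_
        have h1 := htail j (Finset.mem_filter.1 hj).1 1 (by simp)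
        have h2 := htail (opt p.2) hoB (-1) (by simp)
        linarith
    _ = D'.card * (2 * Real.exp (-logTerm T r)) * P.real A := by
        rw [Finset.sum_const, nsmul_eq_mul]; ring
    _ ≤ _ := by
        gcongr

open Classical in
-- The conditional bounds are proportional to the probabilities of the states. These are disjoint,
-- so summing them costs at most a factor 1, rather than the number of states.
lemma measurableSet_and_measureReal_firstBad_le (hX : ∀ k t, Measurable (X k t))
    (hstat : StationaryMeans P T X) {𝒞 : TestClass}
    (hid : (fun x : unitInterval => (x : ℝ)) ∈ 𝒞.unitBall) {α : ℝ} (hα : 1 / 2 < α)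
    (hmix : FastMixing P 𝒞 T X α) (hval : order.IsValid M T) (hK : 1 ≤ K) (hT : 1 ≤ T)
    (hM : 80 * mixSeries α ≤ M)
    (hopt : ∀ B : Finset (Fin K), (∃ k ∈ B, armMean P X k = bestMean P X) →
      opt B ∈ B ∧ armMean P X (opt B) = bestMean P X)
    {r : ℕ} (hr : r ≤ Nat.log 4 T) :
    MeasurableSet {ω | FirstBad (armMean P X) (bestMean P X) opt M T order
        (fun k j => (X k j ω : ℝ)) r} ∧
      P.real {ω | FirstBad (armMean P X) (bestMean P X) opt M T order
        (fun k j => (X k j ω : ℝ)) r}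
      ≤ ((gapSet P X 0).filter fun j => gap P X j < 4 * (1 / 2 : ℝ) ^ r).card
        * (2 * Real.exp (-logTerm T r)) := by
  set I := (Finset.range (T + 1) ×ˢ (Finset.univ : Finset (Finset (Fin K)))).filter
    fun p => 1 ≤ p.1 ∧ p.1 + p.2.card * numPulls M T r ≤ T with hI
  set A : ℕ × Finset (Fin K) → Set Ω :=
    stateEvent (armMean P X) (bestMean P X) opt M T order X r with hA
  set N : ℕ × Finset (Fin K) → Set Ω := fun p => {ω | ¬ EpochOK (armMean P X) (bestMean P X) opt
    M T order (fun k j => (X k j ω : ℝ)) r p.1 p.2} with hN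
  have hAm : ∀ p, MeasurableSet (A p) := fun p => measurableSet_stateEvent' hX _ _ _ _ _
  have e : {ω | FirstBad (armMean P X) (bestMean P X) opt M T order
      (fun k j => (X k j ω : ℝ)) r} = ⋃ p ∈ I, (A p ∩ N p) := by
    ext ω
    simp only [Set.mem_iUnion]
    constructor
    · rintro ⟨h1, h2, h3⟩
      refine ⟨epochState M T order (fun k j => (X k j ω : ℝ)) r, ?_, ⟨rfl, h1⟩, h2⟩
      refine Finset.mem_filter.2 ⟨Finset.mem_product.2 ⟨Finset.mem_range.2 ?_,
        Finset.mem_univ _⟩, one_le_startTime r, h3⟩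
      have := (startTime_mono (Nat.le_succ r)).trans h3
      exact Nat.lt_succ_of_le this
    · rintro ⟨p, hp, ⟨h1, h2⟩, h3⟩
      refine ⟨h2, ?_, ?_⟩
      · rw [startTime, activeArms, h1]; exact h3
      · rw [startTime_succ, startTime, activeArms, h1]
        exact (Finset.mem_filter.1 hp).2.2
  have hdisj : Set.PairwiseDisjoint (↑I) A := by
    intro p _ q _ hpq
    refine Set.disjoint_left.2 fun ω h1 h2 => hpq ?_
    exact h1.1.symm.trans h2.1
  rw [e]
  refine ⟨Finset.measurableSet_biUnion _ fun p hp => (hAm p).inter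
    (jointHistory_le hX _ _ (measurableSet_epochOK _ _ _ (Finset.mem_filter.1 hp).2.1 _)).compl,
    ?_⟩
  set c := (((gapSet P X 0).filter fun j => gap P X j < 4 * (1 / 2 : ℝ) ^ r).card : ℝ)
        * (2 * Real.exp (-logTerm T r)) with hc
  have hc0 : 0 ≤ c := by positivity
  calc P.real (⋃ p ∈ I, (A p ∩ N p)) ≤ ∑ p ∈ I, P.real (A p ∩ N p) :=
        measureReal_biUnion_finset_le _ _
    _ ≤ ∑ p ∈ I, c * P.real (A p) := Finset.sum_le_sum fun p hp =>
        measureReal_stateEvent_not_epochOK_le hX hstat hid hα hmix hval hK hT hM hopt hr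
          (Finset.mem_filter.1 hp).2.1 (Finset.mem_filter.1 hp).2.2
    _ = c * P.real (⋃ p ∈ I, A p) := by
        rw [← Finset.mul_sum, measureReal_biUnion_finset hdisj fun p _ => hAm p]
    _ ≤ c := mul_le_of_le_one_right hc0 measureReal_le_one

/-- The expected cost of the first bad epoch. -/
lemma sum_two_pow_mul_card_le {K : ℕ} (A : Finset (Fin K)) (g : Fin K → ℝ)
    {lam : ℝ} (hlam : 0 < lam) (N : ℕ) :
    ∑ r ∈ (Finset.range N).filter (fun r => lam < 4 * (1 / 2 : ℝ) ^ r),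
        8 * (2 : ℝ) ^ r * ((A.filter fun j => g j < 4 * (1 / 2 : ℝ) ^ r).card : ℝ)
      ≤ ∑ k ∈ A, 64 / max lam (g k) := by
  have e : ∀ r : ℕ, 8 * (2 : ℝ) ^ r * ((A.filter fun j => g j < 4 * (1 / 2 : ℝ) ^ r).card : ℝ)
      = ∑ k ∈ A, if g k < 4 * (1 / 2 : ℝ) ^ r then 8 * (2 : ℝ) ^ r else 0 := by
    intro r
    rw [← Finset.sum_filter, Finset.sum_const, nsmul_eq_mul, mul_comm]
  simp only [e]
  -- After the exchange, arm k contributes a geometric sum over the r with max(lam, g k) < 4θ_r,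
  -- that is 2^r ≤ 4 / max(lam, g k).
  rw [Finset.sum_comm]
  refine Finset.sum_le_sum fun k _ => ?_
  rw [← Finset.sum_filter, Finset.filter_filter, ← Finset.mul_sum]
  have hm : 0 < max lam (g k) := lt_max_of_lt_left hlam
  have h := sum_filter_pow_le (q := 2) (c := 4 / max lam (g k)) (by norm_num) (by positivity)
    (fun r => lam < 4 * (1 / 2 : ℝ) ^ r ∧ g k < 4 * (1 / 2 : ℝ) ^ r)
    (fun r hr => two_pow_le_of_lt hm (max_lt hr.1 hr.2)) N
  calc _ ≤ 8 * (4 / max lam (g k) * (2 / (2 - 1))) := by gcongr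
    _ = _ := by ring

open Classical in
-- Integration of the pathwise bound `sum_gap_decision_le`, in which only the indicators of the
-- first bad epoch are random.
theorem pseudoRegret_improvedUCB_le (hX : ∀ k t, Measurable (X k t))
    (hstat : StationaryMeans P T X) {𝒞 : TestClass}
    (hid : (fun x : unitInterval => (x : ℝ)) ∈ 𝒞.unitBall) {α : ℝ} (hα : 1 / 2 < α)
    (hmix : FastMixing P 𝒞 T X α) (hval : order.IsValid M T) (hK : 1 ≤ K) (hT : 1 ≤ T)
    (hM : 80 * mixSeries α ≤ M) {lam : ℝ} (hlam : 0 < lam)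
    (hlog : ∀ k, lam < gap P X k → -1 ≤ Real.log (T * gap P X k ^ 2)) :
    pseudoRegret P X T (improvedUCB M T order X) ≤ lam * T
      + ∑ k ∈ gapSet P X lam, 16 * (1 + M) ^ 2 *
        ((96 + 32 * Real.log (T * gap P X k ^ 2)) / gap P X k)
      + ∑ k ∈ gapSet P X 0, 64 / max lam (gap P X k) := by
  have hM0 : 0 ≤ M := by linarith [one_le_mixSeries hα]
  have hT0 : (0 : ℝ) < T := by exact_mod_cast hT
  obtain ⟨opt, hopt⟩ : ∃ opt : Finset (Fin K) → Fin K, ∀ B : Finset (Fin K),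
      (∃ k ∈ B, armMean P X k = bestMean P X) →
      opt B ∈ B ∧ armMean P X (opt B) = bestMean P X := by
    refine ⟨fun B => if h : ∃ k ∈ B, armMean P X k = bestMean P X then h.choose else ⟨0, hK⟩,
      fun B hB => ?_⟩
    simp only [hB, dif_pos]
    exact hB.choose_spec
  set FB : ℕ → Set Ω := fun r => {ω | FirstBad (armMean P X) (bestMean P X) opt M T order
        (fun k j => (X k j ω : ℝ)) r} with hFB
  set Rs := (Finset.range (Nat.log 4 T + 1)).filter (fun r => lam < 4 * (1 / 2 : ℝ) ^ r) with hRs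
  set C := ∑ k ∈ gapSet P X lam, 16 * (1 + M) ^ 2 *
        ((96 + 32 * Real.log (T * gap P X k ^ 2)) / gap P X k) with hC
  have hRle : ∀ r ∈ Rs, r ≤ Nat.log 4 T := fun r hr => by
    have := Finset.mem_range.1 (Finset.mem_filter.1 hr).1
    omega
  have hbad := fun r (hr : r ∈ Rs) => measurableSet_and_measureReal_firstBad_le (order := order)
    hX hstat hid hα hmix hval hK hT hM hopt (hRle r hr)
  have hint : ∀ r ∈ Rs, Integrable
      (fun ω => T * (4 * (1 / 2 : ℝ) ^ r) * (FB r).indicator (1 : Ω → ℝ) ω) P := fun r hr =>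
    ((integrable_const (1 : ℝ)).indicator (hbad r hr).1).const_mul _
  have hpath : ∀ ω, ∑ t ∈ Finset.Icc 1 T,
      (bestMean P X - armMean P X (improvedUCB M T order X t ω)) ≤ lam * T + C
        + ∑ r ∈ Rs, T * (4 * (1 / 2 : ℝ) ^ r) * (FB r).indicator (1 : Ω → ℝ) ω := by
    intro ω
    have h := sum_gap_decision_le (x := fun k j => (X k j ω : ℝ)) hval hK hM0 hT
      (armMean_le_bestMean (P := P) (X := X)) (bestMean_sub_armMean_le_one hK)
      (exists_armMean_eq_bestMean hK) hopt hlam.le hlog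
    refine h.trans (le_of_eq ?_)
    congr 1
  calc pseudoRegret P X T (improvedUCB M T order X)
      ≤ ∫ ω, (lam * T + C
        + ∑ r ∈ Rs, T * (4 * (1 / 2 : ℝ) ^ r) * (FB r).indicator (1 : Ω → ℝ) ω) ∂P := by
        -- Nonnegativity and an integrable dominating function suffice here, so measurability of the
        -- decisions is not needed.
        refine integral_mono_of_nonneg (Filter.Eventually.of_forall fun ω =>
          Finset.sum_nonneg fun t _ => sub_nonneg.2 (armMean_le_bestMean _))
          ((integrable_const _).add (integrable_finsetSum _ hint))
          (Filter.Eventually.of_forall hpath)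
    _ = lam * T + C + ∑ r ∈ Rs, T * (4 * (1 / 2 : ℝ) ^ r) * P.real (FB r) := by
        rw [integral_add (integrable_const _) (integrable_finsetSum _ hint),
          integral_finsetSum _ hint]
        congr 1
        · simp
        · refine Finset.sum_congr rfl fun r hr => ?_
          rw [integral_const_mul, integral_indicator_one (hbad r hr).1]
    _ ≤ lam * T + C + ∑ r ∈ Rs, 8 * (2 : ℝ) ^ r
          * (((gapSet P X 0).filter fun j => gap P X j < 4 * (1 / 2 : ℝ) ^ r).card : ℝ) := by
        refine add_le_add le_rfl (Finset.sum_le_sum fun r hr => ?_)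
        have h1 := (hbad r hr).2
        have h2 := exp_neg_logTerm_le hT r
        set n := (((gapSet P X 0).filter fun j => gap P X j < 4 * (1 / 2 : ℝ) ^ r).card : ℝ)
        have h4 : (4 : ℝ) ^ r = (2 : ℝ) ^ r * (2 : ℝ) ^ r := by rw [← mul_pow]; norm_num
        -- The horizon T cancels against exp(-L) ≤ 4^r / T, leaving 4 · 2 · 4^r / 2^r = 8 · 2^r per
        -- arm.
        calc T * (4 * (1 / 2 : ℝ) ^ r) * P.real (FB r)
            ≤ T * (4 * (1 / 2 : ℝ) ^ r) * (n * (2 * ((4 : ℝ) ^ r / T))) := by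
              gcongr
              refine h1.trans ?_
              gcongr
          _ = _ := by rw [half_pow_eq, h4]; field_simp; ring
    _ ≤ _ := by
        gcongr
        exact sum_two_pow_mul_card_le _ _ hlam _

end Regret

/-! ### Constants and conclusion -/

/-- The case n = 1. It yields M₀ ≥ 80 ∑ l^(-1/2-α), which is all that the concentration bound asks
of c₀, since `sum_mixSum_div_le` supplies its own dyadic estimate. -/
lemma AdmissibleConst.one_le {α c : ℝ} (h : AdmissibleConst α c) : 1 ≤ c := by
  simpa using h 1

/-- The threshold on lam gives T d² ≥ √e / 4, whose logarithm is 1/2 - 2 log 2 > -1. -/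
lemma neg_one_le_log_mul_sq {T lam d : ℝ} (hT : 0 < T)
    (hlam : Real.exp (1 / 4) / (2 * √T) ≤ lam) (hd : lam < d) : -1 ≤ Real.log (T * d ^ 2) := by
  have h0 : 0 < Real.exp (1 / 4) / (2 * √T) := by positivity
  have h1 : (Real.exp (1 / 4) / (2 * √T)) ^ 2 ≤ d ^ 2 :=
    pow_le_pow_left₀ h0.le (hlam.trans hd.le) 2
  have h2 : Real.exp (1 / 4) ^ 2 / 4 ≤ T * d ^ 2 := by
    calc Real.exp (1 / 4) ^ 2 / 4 = T * (Real.exp (1 / 4) / (2 * √T)) ^ 2 := by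
          rw [div_pow, mul_pow, Real.sq_sqrt hT.le]
          field_simp
          norm_num
      _ ≤ _ := by gcongr
  have h3 := Real.log_le_log (by positivity) h2
  rw [Real.log_div (by positivity) (by norm_num), Real.log_pow, Real.log_exp] at h3
  have h4 : Real.log 4 = 2 * Real.log 2 := by
    rw [show (4 : ℝ) = 2 ^ 2 by norm_num, Real.log_pow]; norm_num
  have := Real.log_two_lt_d9
  push_cast at h3
  linarith

end MixBandit

end

theorem mainTheorem4 (α : ℝ) (hα : 1 / 2 < α) (c₀ : ℝ) (hc₀ : MixBandit.AdmissibleConst α c₀) :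
    ∃ cα : ℝ, c₀ ≤ cα ∧
      ∀ (K T : ℕ), 1 ≤ K → K < T →
      ∀ (order : MixBandit.PullOrder K), order.IsValid (MixBandit.mixFactor α c₀) T →
      ∀ (Ω : Type*) [MeasurableSpace Ω] (P : MeasureTheory.Measure Ω)
        [MeasureTheory.IsProbabilityMeasure P] (X : Fin K → ℕ → Ω → unitInterval),
        (∀ k t, Measurable (X k t)) →
        MixBandit.StationaryMeans P T X →
      ∀ (𝒞 : MixBandit.TestClass), (fun x : unitInterval => (x : ℝ)) ∈ 𝒞.unitBall →
        MixBandit.FastMixing P 𝒞 T X α →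
      ∀ lam : ℝ, Real.exp (1 / 4) / (2 * Real.sqrt T) ≤ lam →
        MixBandit.pseudoRegret P X T
            (MixBandit.improvedUCB (MixBandit.mixFactor α c₀) T order X)
          ≤ (1 + MixBandit.mixFactor α cα) * ∑ k ∈ MixBandit.gapSet P X lam,
                (MixBandit.gap P X k + 96 / MixBandit.gap P X k
                  + 32 * Real.log (T * MixBandit.gap P X k ^ 2) / MixBandit.gap P X k)
            + 64 * ∑ _k ∈ MixBandit.gapSet P X 0 \ MixBandit.gapSet P X lam, 1 / lam
            + lam * T := by
  classical
  have hc1 : 1 ≤ c₀ := hc₀.one_le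
  have hZ := MixBandit.one_le_mixSeries hα
  have hmf : ∀ c, MixBandit.mixFactor α c = 80 * c * MixBandit.mixSeries α := fun _ => rfl
  set M := MixBandit.mixFactor α c₀ with hM
  have hM80 : 80 * MixBandit.mixSeries α ≤ M := by rw [hM, hmf]; nlinarith
  -- The added (1 + M)² makes the new factor at least 80 (1 + M)², which dominates the 16 (1 + M)²
  -- from the number of pulls.
  refine ⟨c₀ + (1 + M) ^ 2, by nlinarith [sq_nonneg (1 + M)], ?_⟩
  intro K T hK hKT order hval Ω _ P _ X hX hstat 𝒞 hid hmix lam hlam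
  have hT : 1 ≤ T := by omega
  have hT0 : (0 : ℝ) < T := by exact_mod_cast hT
  have hlam0 : 0 < lam := lt_of_lt_of_le (by positivity) hlam
  have hlog : ∀ k, lam < MixBandit.gap P X k → -1 ≤ Real.log (T * MixBandit.gap P X k ^ 2) :=
    fun k hk => MixBandit.neg_one_le_log_mul_sq hT0 hlam hk
  have h := MixBandit.pseudoRegret_improvedUCB_le (order := order) hX hstat hid hα hmix hval hK hT
    hM80 hlam0 hlog
  refine h.trans ?_
  have hsub : MixBandit.gapSet P X lam ⊆ MixBandit.gapSet P X 0 := fun k hk =>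
    Finset.mem_filter.2 ⟨Finset.mem_univ k, hlam0.trans (Finset.mem_filter.1 hk).2⟩
  rw [← Finset.sum_sdiff hsub]
  have hrest : ∑ k ∈ MixBandit.gapSet P X 0 \ MixBandit.gapSet P X lam,
      64 / max lam (MixBandit.gap P X k)
      ≤ 64 * ∑ _k ∈ MixBandit.gapSet P X 0 \ MixBandit.gapSet P X lam, 1 / lam := by
    rw [Finset.mul_sum]
    refine Finset.sum_le_sum fun k _ => ?_
    rw [mul_one_div]
    gcongr
    exact le_max_left _ _
  have hmain : ∑ k ∈ MixBandit.gapSet P X lam, 16 * (1 + M) ^ 2 *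
        ((96 + 32 * Real.log (T * MixBandit.gap P X k ^ 2)) / MixBandit.gap P X k)
      + ∑ k ∈ MixBandit.gapSet P X lam, 64 / max lam (MixBandit.gap P X k)
      ≤ (1 + MixBandit.mixFactor α (c₀ + (1 + M) ^ 2)) * ∑ k ∈ MixBandit.gapSet P X lam,
                (MixBandit.gap P X k + 96 / MixBandit.gap P X k
                  + 32 * Real.log (T * MixBandit.gap P X k ^ 2) / MixBandit.gap P X k) := by
    rw [← Finset.sum_add_distrib, Finset.mul_sum]
    refine Finset.sum_le_sum fun k hk => ?_
    have hgk : lam < MixBandit.gap P X k := (Finset.mem_filter.1 hk).2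
    have hl := hlog k hgk
    set d := MixBandit.gap P X k
    set l := Real.log (T * d ^ 2)
    have hd : 0 < d := hlam0.trans hgk
    have hmax : max lam d = d := max_eq_right hgk.le
    -- Since l ≥ -1, 96 + 32 l ≥ 64: the cost of bad epochs for arms with gap above lam is absorbed
    -- by the main term.
    have hq : 64 / d ≤ (96 + 32 * l) / d := by gcongr; linarith
    have hq0 : 0 ≤ (96 + 32 * l) / d := div_nonneg (by linarith) hd.le
    have hF : 16 * (1 + M) ^ 2 + 1 ≤ 1 + MixBandit.mixFactor α (c₀ + (1 + M) ^ 2) := by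
      rw [hmf]
      nlinarith [sq_nonneg (1 + M), mul_nonneg (sq_nonneg (1 + M)) (sub_nonneg.2 hZ)]
    calc 16 * (1 + M) ^ 2 * ((96 + 32 * l) / d) + 64 / max lam d
        ≤ (16 * (1 + M) ^ 2 + 1) * ((96 + 32 * l) / d) := by rw [hmax]; linarith
      _ ≤ (1 + MixBandit.mixFactor α (c₀ + (1 + M) ^ 2)) * (d + 96 / d + 32 * l / d) := by
        have e : d + 96 / d + 32 * l / d = d + (96 + 32 * l) / d := by ring
        rw [e]
        exact mul_le_mul hF (by linarith) hq0 (le_trans (by positivity) hF)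
  linarith
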